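/- Let $M$ be a smooth manifold of dimension $2n+1$ and let $\eta$ be a contact form on $M$, that is, a smooth $1$-form such that $\eta\wedge(d\eta)^n$ vanishes nowhere. Let $\mathcal R$ be its Reeb vector field ($\eta(\mathcal R)=1$, $d\eta(\mathcal R,\cdot)=0$), let $\flat_x:T_xM\to T_x^*M$, $\flat_x(v)=d\eta(v,\cdot)+\eta(v)\eta$, let $\sharp=\flat^{-1}$, and let $\sharp_\Lambda(\alpha)=\sharp(\alpha)-\alpha(\mathcal R)\mathcal R$. The Hamiltonian vector field of a smooth function $H:M\to\mathbb R$ is $X_H=\sharp_\Lambda(dH)-H\mathcal R$. A submanifold $N\subseteq M$ is called Legendrian if $T_pN=\sharp_\Lambda\big((T_pN)^\circ\big)$ for every $p\in N$, where $(T_pN)^\circ\subseteq T_p^*M$ is the annihilator of $T_pN$; the same definition is used for every contact manifold. On $TM\times\mathbb R$, with $t$ the coordinate of $\mathbb R$, consider the $1$-form $\bar\eta=\eta^c+t\,\eta^v$, where $\eta^c$ and $\eta^v$ are the complete and vertical lifts of $\eta$ to $TM$; in the coordinates $(x^i,\dot x^i)$ of $TM$ induced by coordinates $(x^i)$ of $M$,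 if $\eta=\eta_i\,dx^i$, then $\eta^c=\dot x^k\,\partial_k\eta_i\,dx^i+\eta_i\,d\dot x^i$ and $\eta^v=\eta_i\,dx^i$. Then $(TM\times\mathbb R,\bar\eta)$ is a contact manifold. Moreover, let $X$ be a smooth vector field on $M$ and define $$\bar X=X\times\big(-\mathcal R(\eta(X))\big):M\to TM\times\mathbb R,\qquad p\mapsto\big(X_p,\,-\mathcal R(\eta(X))(p)\big).$$ Then $X=X_H$ for some smooth function $H:M\to\mathbb R$ if and only if the image of $\bar X$ is a Legendrian submanifold of $(TM\times\mathbb R,\bar\eta)$. -/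

import Mathlib

open Set Topology Bundle
open scoped Manifold ContDiff

noncomputable section

namespace Contact

/-! ### One-forms on a manifold and their exterior derivative -/

section Forms

variable {E : Type*} [NormedAddCommGroup E] [NormedSpace ℝ E]
  {H : Type*} [TopologicalSpace H] (I : ModelWithCorners ℝ E H)
  {M : Type*} [TopologicalSpace M] [ChartedSpace H M]

/-- A (not necessarily smooth) vector field on `M`. -/
abbrev VectorField (M : Type*) [TopologicalSpace M] [ChartedSpace H M] : Type _ :=
  ∀ x : M, TangentSpace I x

/-- A (not necessarily smooth) one-form on `M`. -/
abbrev OneForm (M : Type*) [TopologicalSpace M] [ChartedSpace H M] : Type _ :=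
  ∀ x : M, TangentSpace I x →L[ℝ] ℝ

/-- The vector field `X` is smooth: it is a smooth section of the tangent bundle. -/
def IsSmoothField [IsManifold I 1 M] (X : VectorField I M) : Prop :=
  ContMDiff I I.tangent ∞ (fun x ↦ (⟨x, X x⟩ : TangentBundle I M))

/-- The one-form `η` is smooth: it is a smooth section of the cotangent bundle, the bundle of
continuous linear maps from the tangent bundle to the trivial line bundle. -/
def IsSmoothForm [IsManifold I 1 M] (η : OneForm I M) : Prop :=
  ContMDiff I (I.prod 𝓘(ℝ, E →L[ℝ] ℝ)) ∞
    (fun x ↦ TotalSpace.mk' (E →L[ℝ] ℝ)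
      (E := fun x : M ↦ TangentSpace I x →L[ℝ] Bundle.Trivial M ℝ x) x (η x))

/-- The expression of the one-form `η` in the preferred chart `φ` around `x₀`, that is the
pullback of `η` by `φ⁻¹`. -/
def formInChart (η : OneForm I M) (x₀ : M) (y : E) : E →L[ℝ] ℝ :=
  (η ((extChartAt I x₀).symm y)).comp
    (mfderivWithin 𝓘(ℝ, E) I (extChartAt I x₀).symm (range I) y)

/-- The exterior derivative of the chart expression of `η` around `x₀`, at the image of `x₀`:
the bilinear form `(u, v) ↦ D_u α (v) - D_v α (u)` on the model space. -/
def extDerivInChart (η : OneForm I M) (x₀ : M) : E →L[ℝ] E →L[ℝ] ℝ :=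
  fderivWithin ℝ (formInChart I η x₀) (range I) (extChartAt I x₀ x₀) -
    (fderivWithin ℝ (formInChart I η x₀) (range I) (extChartAt I x₀ x₀)).flip

/-- The exterior derivative `dη` of a one-form at `x`: computed in the preferred chart `φ` around
`x` and pulled back by `φ`. The convention is
`dη(X, Y) = X(η(Y)) - Y(η(X)) - η([X, Y])`. -/
def extDerivForm (η : OneForm I M) (x : M) :
    TangentSpace I x →L[ℝ] TangentSpace I x →L[ℝ] ℝ :=
  let L : TangentSpace I x →L[ℝ] E := mfderiv I 𝓘(ℝ, E) (extChartAt I x) x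
  (ContinuousLinearMap.precomp ℝ L).comp ((extDerivInChart I η x).comp L)

end Forms

/-! ### Contact forms -/

/-- The value of `a ∧ bⁿ` (`a` a one-form and `b` a two-form on a vector space `V`) on a family of
`2n+1` vectors, where
`(a ∧ bⁿ)(v) = 2⁻ⁿ ∑_σ sgn(σ) a(v_{σ(0)}) b(v_{σ(1)}, v_{σ(2)}) ⋯ b(v_{σ(2n-1)}, v_{σ(2n)})`.
The `2n+1` slots are indexed as follows: `none` is the slot of `a`, and `some (i, 0)`,
`some (i, 1)` are the two slots of the `i`-th factor `b`. -/
def wedgePow {V : Type*} (a : V → ℝ) (b : V → V → ℝ) (n : ℕ)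
    (v : Option (Fin n × Fin 2) → V) : ℝ :=
  (2 ^ n : ℝ)⁻¹ * ∑ σ : Equiv.Perm (Option (Fin n × Fin 2)),
    ((Equiv.Perm.sign σ : ℤ) : ℝ) *
      (a (v (σ none)) * ∏ i : Fin n, b (v (σ (some (i, 0)))) (v (σ (some (i, 1)))))

section ContactForms

variable {E : Type*} [NormedAddCommGroup E] [NormedSpace ℝ E]
  {H : Type*} [TopologicalSpace H] (I : ModelWithCorners ℝ E H)
  {M : Type*} [TopologicalSpace M] [ChartedSpace H M]

/-- `η` is a contact form on `M`: for some `n`, the manifold `M` has dimension `2n+1`, `η` is a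
smooth one-form, and `η ∧ (dη)ⁿ` does not vanish at any point. -/
def IsContactForm [IsManifold I 1 M] (η : OneForm I M) : Prop :=
  IsSmoothForm I η ∧ ∃ n : ℕ, Module.finrank ℝ E = 2 * n + 1 ∧
    ∀ x : M, ∃ v : Option (Fin n × Fin 2) → TangentSpace I x,
      wedgePow (fun u ↦ η x u) (fun u w ↦ extDerivForm I η x u w) n v ≠ 0

/-- The map `♭ : T_x M → T_x^* M`, `v ↦ dη(v, ·) + η(v) η`. -/
def flat (η : OneForm I M) (x : M) :
    TangentSpace I x →L[ℝ] (TangentSpace I x →L[ℝ] ℝ) :=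
  extDerivForm I η x + (η x).smulRight (η x)

/-- The map `♯ = ♭⁻¹ : T_x^* M → T_x M` (by convention zero if `♭` is not invertible, which does
not happen for a contact form). -/
def sharp (η : OneForm I M) (x : M) :
    (TangentSpace I x →L[ℝ] ℝ) →L[ℝ] TangentSpace I x :=
  (flat I η x).inverse

/-- The Reeb vector field: `reeb x` is the vector `R` in `T_x M`, unique for a contact form, with
`η(R) = 1` and `dη(R, ·) = 0`. -/
def reeb (η : OneForm I M) : VectorField I M := fun x ↦
  Classical.epsilon fun R : TangentSpace I x ↦
    η x R = 1 ∧ ∀ w : TangentSpace I x, extDerivForm I η x R w = 0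

/-- The map `♯_Λ : T_x^* M → T_x M` of the Jacobi structure of a contact form,
`♯_Λ(α) = ♯(α) - α(R) R`. It is the map `α ↦ Λ(α, ·)` for the bivector
`Λ(α, β) = -dη(♯α, ♯β)`. -/
def sharpLambda (η : OneForm I M) (x : M) (α : TangentSpace I x →L[ℝ] ℝ) : TangentSpace I x :=
  sharp I η x α - α (reeb I η x) • reeb I η x

/-- The contact complement `♯_Λ(Δ°)` of `Δ ⊆ T_x M`, where `Δ°` is the annihilator of `Δ`. -/
def contactComplement (η : OneForm I M) (x : M) (Δ : Set (TangentSpace I x)) :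
    Set (TangentSpace I x) :=
  sharpLambda I η x '' {α | ∀ v ∈ Δ, α v = 0}

/-- The derivative `Y(f)` of the function `f` along the vector field `Y`. -/
def dirDeriv (Y : VectorField I M) (f : M → ℝ) (x : M) : ℝ :=
  mfderiv I 𝓘(ℝ, ℝ) f x (Y x)

/-- The contact Hamiltonian vector field `X_F = ♯_Λ(dF) - F R` of the function `F`. -/
def hamiltonianField (η : OneForm I M) (F : M → ℝ) : VectorField I M := fun x ↦
  sharpLambda I η x (mfderiv I 𝓘(ℝ, ℝ) F x) - F x • reeb I η x

/-- `X` is a contact Hamiltonian vector field: it is `X_F` for some smooth function `F`. -/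
def IsHamiltonianField (η : OneForm I M) (X : VectorField I M) : Prop :=
  ∃ F : M → ℝ, ContMDiff I 𝓘(ℝ, ℝ) ∞ F ∧ X = hamiltonianField I η F

/-! ### Submanifolds -/

/-- `N` is an (embedded, smooth) submanifold of `M`: around each of its points there is a chart of
the smooth structure of `M` in which `N` is a linear subspace of the model space. -/
def IsSubmanifold (N : Set M) : Prop :=
  ∀ p ∈ N, ∃ φ ∈ IsManifold.maximalAtlas I ∞ M, p ∈ φ.source ∧
    ∃ S : Submodule ℝ E, ∀ q ∈ φ.source, q ∈ N ↔ φ.extend I q ∈ S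

/-- The tangent space `T_p N` of a submanifold `N`, inside `T_p M`: the velocities at time `0` of
the smooth curves through `p` that lie in `N`. -/
def tangentSpaceOf (N : Set M) (p : M) : Set (TangentSpace I p) :=
  {v | ∃ γ : ℝ → M, γ 0 = p ∧ ContMDiffAt 𝓘(ℝ, ℝ) I ∞ γ 0 ∧ (∀ᶠ t in 𝓝 (0 : ℝ), γ t ∈ N) ∧
    (mfderiv 𝓘(ℝ, ℝ) I γ 0 (1 : ℝ) : E) = (v : E)}

/-- `N` is a Legendrian submanifold of `(M, η)`: a submanifold whose tangent spaces are equal to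
their contact complements. -/
def IsLegendrian (η : OneForm I M) (N : Set M) : Prop :=
  IsSubmanifold I N ∧
    ∀ p ∈ N, tangentSpaceOf I N p = contactComplement I η p (tangentSpaceOf I N p)

end ContactForms

/-! ### Lifts to the tangent bundle -/

section Lifts

variable {E : Type*} [NormedAddCommGroup E] [NormedSpace ℝ E]
  {H : Type*} [TopologicalSpace H] (I : ModelWithCorners ℝ E H)
  {M : Type*} [TopologicalSpace M] [ChartedSpace H M] [IsManifold I 1 M]

/-- The differential at `v` of the projection `τ : TM → M`. -/
def dproj (v : TangentBundle I M) : TangentSpace I.tangent v →L[ℝ] TangentSpace I v.proj :=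
  mfderiv I.tangent I (fun w : TangentBundle I M ↦ w.proj) v

/-- The vertical lift `η^v = τ^* η` of a one-form to the tangent bundle. -/
def verticalLift (η : OneForm I M) : OneForm I.tangent (TangentBundle I M) := fun v ↦
  (η v.proj).comp (dproj I v)

/-- The complete lift `η^c` of a one-form to the tangent bundle. It is written invariantly as
`η^c_v = (d η̂)_v + dη(v, dτ(·))`, where `η̂ : TM → ℝ` is the function `v ↦ η(v)`. In the
coordinates `(xⁱ, ẋⁱ)` of `TM` induced by coordinates `(xⁱ)` of `M`, this is
`(η_i dxⁱ)^c = ẋᵏ (∂_k η_i) dxⁱ + η_i dẋⁱ`. -/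
def completeLift (η : OneForm I M) : OneForm I.tangent (TangentBundle I M) := fun v ↦
  let dη_hat : TangentSpace I.tangent v →L[ℝ] ℝ :=
    mfderiv I.tangent 𝓘(ℝ, ℝ) (fun w : TangentBundle I M ↦ η w.proj w.snd) v
  dη_hat + (extDerivForm I η v.proj v.snd).comp (dproj I v)

/-- The one-form `η^c + t η^v` on `TM × ℝ`, where `t` is the coordinate of `ℝ` and the lifts are
pulled back to the product. -/
def extendedForm (η : OneForm I M) :
    OneForm (I.tangent.prod 𝓘(ℝ, ℝ)) (TangentBundle I M × ℝ) := fun p ↦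
  (completeLift I η p.1 + p.2 • verticalLift I η p.1).comp
    (mfderiv (I.tangent.prod 𝓘(ℝ, ℝ)) I.tangent
      (Prod.fst : TangentBundle I M × ℝ → TangentBundle I M) p)

/-- The extended vector field `X̄ = X × (-R(η(X))) : M → TM × ℝ`. -/
def extendedField (η : OneForm I M) (X : VectorField I M) (x : M) : TangentBundle I M × ℝ :=
  (⟨x, X x⟩, -dirDeriv I (reeb I η) (fun y ↦ η y (X y)) x)

end Lifts

end Contact

end

/-!
A contact form and its differential make every tangent space `V` a linear contact space, given by
a pair `(a, b)` for which the kernels of `a` and `b` meet only in `0`. In the chart of `TM × ℝ`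
induced by a chart of `M`, the extended form and its differential arise from such a pair by
splitting `V × V` into a horizontal and a vertical part, and this construction preserves linear
contact spaces.

Put `f = η(X)`. Contracting `X = X_H` with `η` and `dη` forces `H = -f` and turns the equation into
`df + dη(X, ·) = R(f) η`, that is, `L_X η = R(f) η`. Since `X̄` has third component `-R(f)`, the
pullback of the extended form along `X̄` is `df + dη(X, ·) - R(f) η`, so `X` is Hamiltonian if and
only if the image of `X̄` is isotropic. The dimension of this image is half of that of the contact
hyperplanes, so isotropic means Legendrian. Finally the image of `X̄` is the set of fixed points of
the smooth retraction `(v, t) ↦ X̄(τ v)` of `TM × ℝ`, hence a submanifold: in suitable coordinates a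
smooth idempotent map agrees with its linear part.
-/

noncomputable section

namespace Contact

section SymplecticLinearAlgebra

variable {K V : Type*} [Field K] [AddCommGroup V] [Module K V] {b : LinearMap.BilinForm K V}

/-- The family `e`, listed in pairs `e (i, 0), e (i, 1)`, is symplectic for `b`: its Gram matrix
is block diagonal, with blocks `!![0, 1; -1, 0]`. -/
def IsSymplecticFamily {ι : Type*} [DecidableEq ι] (b : LinearMap.BilinForm K V)
    (e : ι × Fin 2 → V) : Prop :=
  ∀ p q, b (e p) (e q) = if p.1 = q.1 then !![0, 1; -1, 0] p.2 q.2 else 0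

theorem disjoint_span_pair_orthogonal (hb : b.IsAlt) {x y : V} (hxy : b x y = 1) :
    Disjoint (Submodule.span K {x, y}) (b.orthogonal (Submodule.span K {x, y})) := by
  rw [Submodule.disjoint_def]
  intro v hv hv'
  obtain ⟨s, t, rfl⟩ := Submodule.mem_span_pair.1 hv
  have hyx : b y x = -1 := by rw [← hb.neg_eq, hxy]
  have ht : t = 0 := by
    simpa [hxy, hb.self_eq_zero] using hv' x (Submodule.mem_span_of_mem (mem_insert x {y}))
  have hs : s = 0 := by
    simpa [hyx, hb.self_eq_zero] using
      hv' y (Submodule.mem_span_of_mem (mem_insert_of_mem x (mem_singleton y)))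
  simp [hs, ht]

theorem finrank_span_pair (hb : b.IsAlt) {x y : V} (hxy : b x y = 1) :
    Module.finrank K (Submodule.span K {x, y}) = 2 := by
  have hindep : LinearIndependent K ![x, y] := by
    refine LinearIndependent.pair_iff.2 fun s t hst ↦ ?_
    have hs : b (s • x + t • y) y = 0 := by simp [hst]
    have ht : b x (s • x + t • y) = 0 := by simp [hst]
    simpa [hxy, hb.self_eq_zero] using And.intro hs ht
  rw [← Matrix.range_cons_cons_empty x y ![]]
  exact finrank_span_eq_card hindep

theorem IsSymplecticFamily.cons {n : ℕ} (hb : b.IsAlt) {x y : V} (hxy : b x y = 1)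
    {e : Fin n × Fin 2 → V} (he : IsSymplecticFamily b e) (hx : ∀ p, b x (e p) = 0)
    (hy : ∀ p, b y (e p) = 0) :
    IsSymplecticFamily b fun p : Fin (n + 1) × Fin 2 ↦
      (Fin.cons ![x, y] fun i k ↦ e (i, k) : Fin (n + 1) → Fin 2 → V) p.1 p.2 := by
  have hyx : b y x = -1 := by rw [← hb.neg_eq, hxy]
  have hx' : ∀ p, b (e p) x = 0 := fun p ↦ by rw [← hb.neg_eq, hx, neg_zero]
  have hy' : ∀ p, b (e p) y = 0 := fun p ↦ by rw [← hb.neg_eq, hy, neg_zero]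
  rintro ⟨i, k⟩ ⟨j, l⟩
  cases i using Fin.cases <;> cases j using Fin.cases
  · fin_cases k <;> fin_cases l <;> simp [hxy, hyx, hb.self_eq_zero]
  · fin_cases k <;> simp [hx, hy, (Fin.succ_ne_zero _).symm]
  · fin_cases l <;> simp [hx', hy']
  · simpa using he _ _

theorem exists_isSymplecticFamily [FiniteDimensional K V] (hb : b.IsAlt) (hnd : b.Nondegenerate) :
    ∃ n, Module.finrank K V = 2 * n ∧ ∃ e : Fin n × Fin 2 → V, IsSymplecticFamily b e := by
  induction hm : Module.finrank K V using Nat.strong_induction_on generalizing V with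
  | _ m ih =>
    subst hm
    rcases Nat.eq_zero_or_pos (Module.finrank K V) with h0 | hpos
    · exact ⟨0, h0, fun p ↦ p.1.elim0, fun p ↦ p.1.elim0⟩
    have := Module.nontrivial_of_finrank_pos hpos
    obtain ⟨x, y, hxy⟩ : ∃ x y, b x y = 1 := by
      obtain ⟨x, hx⟩ := exists_ne (0 : V)
      obtain ⟨z, hz⟩ : ∃ z, b x z ≠ 0 := by
        by_contra! h
        exact hx (hnd.1 x h)
      exact ⟨x, (b x z)⁻¹ • z, by simp [hz]⟩
    let P := Submodule.span K {x, y}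
    have hP : Disjoint P (b.orthogonal P) := disjoint_span_pair_orthogonal hb hxy
    have hx : x ∈ P := Submodule.mem_span_of_mem (mem_insert x {y})
    have hy : y ∈ P := Submodule.mem_span_of_mem (mem_insert_of_mem x (mem_singleton y))
    have hP_dim : Module.finrank K P = 2 := finrank_span_pair hb hxy
    have hdim : Module.finrank K (b.orthogonal P) = Module.finrank K V - 2 := by
      rw [LinearMap.BilinForm.finrank_orthogonal hnd, hP_dim]
    have hPV : 2 ≤ Module.finrank K V := hP_dim ▸ Submodule.finrank_le P
    have hnd' : (b.restrict (b.orthogonal P)).Nondegenerate := by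
      refine b.nondegenerate_restrict_of_disjoint_orthogonal hb.isRefl ?_
      rw [LinearMap.BilinForm.orthogonal_orthogonal hnd hb.isRefl]
      exact hP.symm
    obtain ⟨n, hn, e, he⟩ := ih _ (by omega) (b := b.restrict (b.orthogonal P))
      (fun v ↦ hb v) hnd' rfl
    exact ⟨n + 1, by omega, _, IsSymplecticFamily.cons (e := fun p ↦ (e p : V)) hb hxy he
      (fun p ↦ (e p).2 x hx) fun p ↦ (e p).2 y hy⟩

end SymplecticLinearAlgebra

section ContactLinearAlgebra

variable {K V : Type*} [Field K] [AddCommGroup V] [Module K V]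
  {a : V →ₗ[K] K} {b : LinearMap.BilinForm K V}

/-- The pair `(a, b)` is a linear contact structure on `V`: `b` is alternating, the kernels of `a`
and `b` meet trivially, and there is a Reeb vector. In dimension `2n + 1` over `ℝ` this is
equivalent to `a ∧ bⁿ ≠ 0`, but it does not mention the dimension. -/
structure IsContactPair (a : V →ₗ[K] K) (b : LinearMap.BilinForm K V) : Prop where
  isAlt : b.IsAlt
  eq_zero : ∀ v, a v = 0 → (∀ w, b v w = 0) → v = 0
  exists_reeb : ∃ R, a R = 1 ∧ ∀ w, b R w = 0

theorem IsContactPair.ext (h : IsContactPair a b) {u v : V} (ha : a u = a v)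
    (hb : ∀ w, b u w = b v w) : u = v :=
  sub_eq_zero.1 (h.eq_zero _ (by simp [ha]) fun w ↦ by simp [hb])

theorem IsContactPair.apply_reeb (h : IsContactPair a b) {R : V} (hR : ∀ w, b R w = 0) (w : V) :
    b w R = 0 := by
  rw [← h.isAlt.neg_eq, hR, neg_zero]

theorem IsContactPair.nondegenerate_restrict_ker (h : IsContactPair a b) :
    (b.restrict a.ker).Nondegenerate := by
  obtain ⟨R, haR, hR⟩ := h.exists_reeb
  have hrefl : (b.restrict a.ker).IsRefl := LinearMap.BilinForm.IsAlt.isRefl fun v ↦ h.isAlt v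
  refine hrefl.nondegenerate_iff_separatingLeft.2 fun v hv ↦
    Subtype.ext (h.eq_zero v v.2 fun w ↦ ?_)
  have hw : b v (w - a w • R) = 0 := hv ⟨w - a w • R, by simp [haR]⟩
  simpa [h.apply_reeb hR] using hw

theorem IsContactPair.finrank_ker_add_one [FiniteDimensional K V] (h : IsContactPair a b) :
    Module.finrank K a.ker + 1 = Module.finrank K V := by
  obtain ⟨R, haR, -⟩ := h.exists_reeb
  have ha : a ≠ 0 := by
    rintro rfl
    simp at haR
  exact Module.Dual.finrank_ker_add_one_of_ne_zero ha

theorem IsContactPair.of_odd_finrank [FiniteDimensional K V] (hb : b.IsAlt)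
    (h : ∀ v, a v = 0 → (∀ w, b v w = 0) → v = 0) (hV : Odd (Module.finrank K V)) :
    IsContactPair a b := by
  refine ⟨hb, h, ?_⟩
  obtain ⟨v, hv, hv0⟩ : ∃ v, (∀ w, b v w = 0) ∧ v ≠ 0 := by
    by_contra! hsep
    obtain ⟨n, hn, -⟩ :=
      exists_isSymplecticFamily hb (hb.isRefl.nondegenerate_iff_separatingLeft.2 hsep)
    exact Nat.not_odd_iff_even.2 (even_iff_exists_two_mul.2 ⟨n, hn⟩) hV
  have hav : a v ≠ 0 := fun h0 ↦ hv0 (h v h0 hv)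
  exact ⟨(a v)⁻¹ • v, by simp [hav], fun w ↦ by simp [hv]⟩

theorem IsContactPair.mem_of_isotropic [FiniteDimensional K V] (h : IsContactPair a b)
    {Δ : Submodule K V} (hΔ : Module.finrank K V = 2 * Module.finrank K Δ + 1)
    (ha : ∀ v ∈ Δ, a v = 0) (hb : ∀ v ∈ Δ, ∀ w ∈ Δ, b v w = 0) {u : V} (hau : a u = 0)
    (hbu : ∀ w ∈ Δ, b u w = 0) : u ∈ Δ := by
  let B := b.restrict a.ker
  let Δ' := Δ.comap a.ker.subtype
  have hrefl : B.IsRefl := LinearMap.BilinForm.IsAlt.isRefl fun v ↦ h.isAlt v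
  have hΔ' : Module.finrank K Δ' = Module.finrank K Δ :=
    (Submodule.comapSubtypeEquivOfLe (p := Δ) (q := a.ker) ha).finrank_eq
  have hisotropic : Δ' ≤ B.orthogonal Δ' := fun v hv w hw ↦ hb w hw v hv
  have hlagrangian : Δ' = B.orthogonal Δ' := by
    refine Submodule.eq_of_le_of_finrank_le hisotropic ?_
    rw [LinearMap.BilinForm.finrank_orthogonal h.nondegenerate_restrict_ker]
    have := h.finrank_ker_add_one
    omega
  have hu : (⟨u, hau⟩ : a.ker) ∈ B.orthogonal Δ' := fun w hw ↦ hrefl _ _ (hbu w hw)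
  rw [← hlagrangian] at hu
  exact hu

/-- The pointwise algebra of the extended form: with `V × V` split into horizontal and vertical
parts, `η^c + t η^v` and its differential have this shape. -/
theorem IsContactPair.tangentLift (h : IsContactPair a b) {a' : (V × V) × K →ₗ[K] K}
    {b' : LinearMap.BilinForm K ((V × V) × K)} (l : V →ₗ[K] K) {s : LinearMap.BilinForm K V}
    (hs : s.IsAlt) (ha' : ∀ u, a' u = l u.1.1 + a u.1.2)
    (hb' : ∀ u w, b' u w = s u.1.1 w.1.1 + b u.1.2 w.1.1 + b u.1.1 w.1.2 + u.2 * a w.1.1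
      - w.2 * a u.1.1) :
    IsContactPair a' b' := by
  refine ⟨fun u ↦ ?_, fun ⟨⟨x, y⟩, t⟩ ha hb ↦ ?_, ?_⟩
  · rw [hb', ← h.isAlt.neg_eq u.1.1 u.1.2, hs]
    ring
  · have hax : a x = 0 := by simpa [hb'] using hb ((0, 0), 1)
    have hbx : ∀ w, b x w = 0 := fun w ↦ by simpa [hb'] using hb ((0, w), 0)
    obtain rfl : x = 0 := h.eq_zero x hax hbx
    obtain ⟨R, haR, hR⟩ := h.exists_reeb
    have hay : a y = 0 := by simpa [ha'] using ha
    have hby : ∀ w, b y w + t * a w = 0 := fun w ↦ by simpa [hb'] using hb ((w, 0), 0)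
    obtain rfl : t = 0 := by simpa [haR, h.apply_reeb hR] using hby R
    obtain rfl : y = 0 := h.eq_zero y hay fun w ↦ by simpa using hby w
    rfl
  · obtain ⟨R, haR, hR⟩ := h.exists_reeb
    exact ⟨((0, R), 0), by simp [ha', haR], fun w ↦ by simp [hb', hR]⟩

end ContactLinearAlgebra

section WedgePower

theorem exists_basis_apply_eq {K V ι : Type*} [Field K] [AddCommGroup V] [Module K V]
    [FiniteDimensional K V] [Fintype ι] (hι : Fintype.card ι = Module.finrank K V) {u : V}
    (hu : u ≠ 0) : ∃ (B : Module.Basis ι K V) (i : ι), B i = u := by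
  let B := Module.Basis.extend (LinearIndepOn.singleton (R := K) (v := id) hu)
  have := Module.Finite.finite_basis B
  let e := (B.indexEquiv (Module.finBasis K V)).trans (Fintype.equivFinOfCardEq hι).symm
  refine ⟨B.reindex e, e ⟨u, Module.Basis.subset_extend _ (mem_singleton u)⟩, ?_⟩
  simp [B]

theorem sign_eq_prod_of_permutes_pairs {ι : Type*} [Fintype ι] [DecidableEq ι]
    {σ : Equiv.Perm (Option (ι × Fin 2))} (hσ : σ none = none) (q : ι → ι)
    (ε : ι → Equiv.Perm (Fin 2)) (h : ∀ i k, σ (some (i, k)) = some (q i, ε i k)) :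
    Equiv.Perm.sign σ = ∏ i, Equiv.Perm.sign (ε i) := by
  have hq : Function.Injective q := by
    intro i j hij
    have : σ (some (i, (ε i).symm 0)) = σ (some (j, (ε j).symm 0)) := by simp [h, hij]
    exact congrArg Prod.fst (Option.some_injective _ (σ.injective this))
  let q' : Equiv.Perm ι := Equiv.ofBijective q hq.bijective_of_finite
  have hσ' : σ = Equiv.optionCongr (Equiv.prodCongrLeft fun _ : Fin 2 ↦ q') *
      Equiv.optionCongr (Equiv.prodCongrRight ε) := by
    ext1 x
    rcases x with _ | ⟨i, k⟩
    · simp [hσ]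
    · simp [h, q']
  rw [hσ', Equiv.Perm.sign_mul, Equiv.optionCongr_sign, Equiv.optionCongr_sign,
    Equiv.Perm.sign_prodCongrLeft, Equiv.Perm.sign_prodCongrRight]
  simp

theorem IsSymplecticFamily.exists_perm_of_apply_ne_zero {K V ι : Type*} [Field K] [AddCommGroup V]
    [Module K V] [DecidableEq ι] {b : LinearMap.BilinForm K V} {e : ι × Fin 2 → V}
    (he : IsSymplecticFamily b e) {p q : ι × Fin 2} (hpq : b (e p) (e q) ≠ 0) :
    ∃ (j : ι) (ε : Equiv.Perm (Fin 2)), p = (j, ε 0) ∧ q = (j, ε 1) ∧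
      b (e p) (e q) = ((Equiv.Perm.sign ε : ℤ) : K) := by
  obtain ⟨j, k⟩ := p
  obtain ⟨j', k'⟩ := q
  rw [he] at hpq ⊢
  obtain rfl : j = j' := by
    by_contra hne
    simp [hne] at hpq
  fin_cases k <;> fin_cases k'
  · simp at hpq
  · exact ⟨j, Equiv.refl _, by simp⟩
  · exact ⟨j, Equiv.swap 0 1, by simp⟩
  · simp at hpq

variable {V : Type*} [AddCommGroup V] [Module ℝ V] {a : V →ₗ[ℝ] ℝ} {b : LinearMap.BilinForm ℝ V}
  {n : ℕ}

theorem prod_update_pairs (b : LinearMap.BilinForm ℝ V) (v : Option (Fin n × Fin 2) → V) (j : Fin n)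
    (k : Fin 2) (z : V) :
    ∏ i, b (Function.update v (some (j, k)) z (some (i, 0)))
        (Function.update v (some (j, k)) z (some (i, 1))) =
      (if k = 0 then b z (v (some (j, 1))) else b (v (some (j, 0))) z) *
        ∏ i ∈ Finset.univ.erase j, b (v (some (i, 0))) (v (some (i, 1))) := by
  rw [← Finset.mul_prod_erase _ _ (Finset.mem_univ j)]
  congr 1
  · fin_cases k <;> simp
  · refine Finset.prod_congr rfl fun i hi ↦ ?_
    simp [Finset.ne_of_mem_erase hi]

/-- The multilinear map `a ⊗ b ⊗ ⋯ ⊗ b`, with the slots indexed as in `wedgePow`. -/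
def tensorPow (a : V →ₗ[ℝ] ℝ) (b : LinearMap.BilinForm ℝ V) (n : ℕ) :
    MultilinearMap ℝ (fun _ : Option (Fin n × Fin 2) ↦ V) ℝ :=
  MultilinearMap.mk'
    (fun v ↦ a (v none) * ∏ i : Fin n, b (v (some (i, 0))) (v (some (i, 1))))
    (by
      rintro v (_ | ⟨j, k⟩) x y
      · simp [add_mul]
      · simp only [prod_update_pairs]
        split_ifs <;> simp <;> ring)
    (by
      rintro v (_ | ⟨j, k⟩) c x
      · simp [mul_assoc]
      · simp only [prod_update_pairs]
        split_ifs <;> simp <;> ring)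

theorem tensorPow_apply (v : Option (Fin n × Fin 2) → V) :
    tensorPow a b n v = a (v none) * ∏ i : Fin n, b (v (some (i, 0))) (v (some (i, 1))) := rfl

theorem wedgePow_eq_alternatization (v : Option (Fin n × Fin 2) → V) :
    wedgePow (fun u ↦ a u) (fun u w ↦ b u w) n v =
      (2 ^ n : ℝ)⁻¹ * (tensorPow a b n).alternatization v := by
  rw [wedgePow, MultilinearMap.alternatization_apply]
  simp only [Units.smul_def, zsmul_eq_mul, MultilinearMap.domDomCongr_apply, tensorPow_apply]

theorem tensorPow_eq_zero (hb : b.IsAlt) {v : Option (Fin n × Fin 2) → V}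
    (i : Option (Fin n × Fin 2)) (ha : a (v i) = 0) (hi : ∀ w, b (v i) w = 0) :
    tensorPow a b n v = 0 := by
  rw [tensorPow_apply]
  rcases i with _ | ⟨j, k⟩
  · rw [ha, zero_mul]
  · rw [Finset.prod_eq_zero (Finset.mem_univ j), mul_zero]
    fin_cases k
    · exact hi _
    · exact hb.isRefl _ _ (hi _)

/-- A nonzero vector `u` in both kernels is part of a basis, on which a nonzero form of top degree
cannot vanish; but `a ∧ bⁿ` does. -/
theorem eq_zero_of_wedgePow_ne_zero (hb : b.IsAlt) (hn : Module.finrank ℝ V = 2 * n + 1)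
    {v : Option (Fin n × Fin 2) → V}
    (hv : wedgePow (fun u ↦ a u) (fun u w ↦ b u w) n v ≠ 0) {u : V} (hau : a u = 0)
    (hbu : ∀ w, b u w = 0) : u = 0 := by
  by_contra hu
  have : FiniteDimensional ℝ V := Module.finite_of_finrank_pos (by omega)
  rw [wedgePow_eq_alternatization] at hv
  have hf : (tensorPow a b n).alternatization ≠ 0 := by
    intro h
    simp [h] at hv
  obtain ⟨B, i, rfl⟩ := exists_basis_apply_eq (ι := Option (Fin n × Fin 2)) (K := ℝ)
    (by simp [hn, mul_comm]) hu
  refine (AlternatingMap.map_basis_ne_zero_iff B _).2 hf ?_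
  rw [MultilinearMap.alternatization_apply]
  refine Finset.sum_eq_zero fun σ _ ↦ ?_
  rw [MultilinearMap.domDomCongr_apply, tensorPow_eq_zero hb (σ.symm i), smul_zero]
  · simpa using hau
  · simpa using hbu

theorem sign_smul_tensorPow_nonneg (hb : b.IsAlt) {R : V} (haR : a R = 1) (hR : ∀ w, b R w = 0)
    {e : Fin n × Fin 2 → V} (hae : ∀ p, a (e p) = 0) (he : IsSymplecticFamily b e)
    (σ : Equiv.Perm (Option (Fin n × Fin 2))) :
    0 ≤ Equiv.Perm.sign σ • tensorPow a b n fun i ↦ (σ i).elim R e := by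
  by_cases hz : (tensorPow a b n fun i ↦ (σ i).elim R e) = 0
  · rw [hz, smul_zero]
  rw [tensorPow_apply, mul_eq_zero, not_or, Finset.prod_eq_zero_iff] at hz
  have hσ : σ none = none := by
    rcases hs : σ none with _ | p
    · rfl
    · exact absurd (by simp [hs, hae]) hz.1
  have hpairs : ∀ i, ∃ (j : Fin n) (ε : Equiv.Perm (Fin 2)),
      (∀ k, σ (some (i, k)) = some (j, ε k)) ∧
      b ((σ (some (i, 0))).elim R e) ((σ (some (i, 1))).elim R e) =
        ((Equiv.Perm.sign ε : ℤ) : ℝ) := by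
    intro i
    have hi : b ((σ (some (i, 0))).elim R e) ((σ (some (i, 1))).elim R e) ≠ 0 := fun h ↦
      hz.2 ⟨i, Finset.mem_univ i, h⟩
    rcases hp : σ (some (i, 0)) with _ | p
    · simp [hp, hR] at hi
    rcases hq : σ (some (i, 1)) with _ | q
    · exact absurd (hb.isRefl _ _ (hR _)) (by simpa [hq] using hi)
    rw [hp, hq] at hi
    obtain ⟨j, ε, rfl, rfl, hsign⟩ := he.exists_perm_of_apply_ne_zero hi
    exact ⟨j, ε, Fin.forall_fin_two.2 ⟨hp, hq⟩, hsign⟩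
  choose q ε hq hε using hpairs
  have hone : Equiv.Perm.sign σ • (tensorPow a b n fun i ↦ (σ i).elim R e) = 1 := by
    have hprod : (tensorPow a b n fun i ↦ (σ i).elim R e) = ((Equiv.Perm.sign σ : ℤ) : ℝ) := by
      rw [tensorPow_apply, hσ, sign_eq_prod_of_permutes_pairs hσ q ε hq]
      simp only [Option.elim_none, haR, one_mul, hε]
      push_cast
      rfl
    rw [hprod, Units.smul_def, zsmul_eq_mul, ← Int.cast_mul, ← Units.val_mul, Int.units_mul_self]
    simp
  rw [hone]
  exact zero_le_one

/-- On a Reeb vector and a symplectic basis of `ker a`, every term of the alternating sum is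
nonnegative, and the term of the identity permutation is `1`. -/
theorem IsContactPair.exists_wedgePow_ne_zero (h : IsContactPair a b)
    (hn : Module.finrank ℝ V = 2 * n + 1) :
    ∃ v, wedgePow (fun u ↦ a u) (fun u w ↦ b u w) n v ≠ 0 := by
  have : FiniteDimensional ℝ V := Module.finite_of_finrank_pos (by omega)
  obtain ⟨R, haR, hR⟩ := h.exists_reeb
  obtain ⟨m, hm, e, he⟩ :=
    exists_isSymplecticFamily (b := b.restrict a.ker) (fun v ↦ h.isAlt v)
      h.nondegenerate_restrict_ker
  have hker := h.finrank_ker_add_one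
  obtain rfl : n = m := by omega
  have he' : IsSymplecticFamily b fun p ↦ (e p : V) := he
  refine ⟨fun i ↦ i.elim R fun p ↦ (e p : V), ?_⟩
  rw [wedgePow_eq_alternatization, MultilinearMap.alternatization_apply]
  refine mul_ne_zero (by positivity) (ne_of_gt ?_)
  refine Finset.sum_pos' (fun σ _ ↦ ?_) ⟨1, Finset.mem_univ _, ?_⟩
  · exact sign_smul_tensorPow_nonneg h.isAlt haR hR (fun p ↦ (e p).2) he' σ
  · rw [MultilinearMap.domDomCongr_apply, tensorPow_apply]
    simp [haR, he' _ _]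

theorem IsContactPair.of_wedgePow_ne_zero (hb : b.IsAlt) (hn : Module.finrank ℝ V = 2 * n + 1)
    {v : Option (Fin n × Fin 2) → V}
    (hv : wedgePow (fun u ↦ a u) (fun u w ↦ b u w) n v ≠ 0) : IsContactPair a b := by
  have : FiniteDimensional ℝ V := Module.finite_of_finrank_pos (by omega)
  exact .of_odd_finrank hb (fun _ ↦ eq_zero_of_wedgePow_ne_zero hb hn hv) ⟨n, hn⟩

end WedgePower

section SharpLambda

variable {V : Type*} [AddCommGroup V] [Module ℝ V] [TopologicalSpace V] [IsTopologicalAddGroup V]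
  [ContinuousSMul ℝ V] [T2Space V] [FiniteDimensional ℝ V] {a : V →L[ℝ] ℝ} {b : V →L[ℝ] V →L[ℝ] ℝ}

theorem IsContactPair.isInvertible_flat (h : IsContactPair a.toLinearMap b.toBilinForm) :
    (b + a.smulRight a).IsInvertible := by
  have hinj : Function.Injective (b + a.smulRight a) := by
    refine (injective_iff_map_eq_zero _).2 fun v hv ↦ ?_
    have hv' : ∀ w, b v w + a v * a w = 0 := fun w ↦ by simpa using DFunLike.congr_fun hv w
    have hav : a v = 0 := by simpa [show b v v = 0 from h.isAlt v] using hv' v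
    exact h.eq_zero v hav fun w ↦ by simpa [hav] using hv' w
  have hfinrank : Module.finrank ℝ V = Module.finrank ℝ (V →L[ℝ] ℝ) := by
    rw [← LinearMap.toContinuousLinearMap.finrank_eq]
    exact Subspace.dual_finrank_eq.symm
  have hsurj := (LinearMap.injective_iff_surjective_of_finrank_eq_finrank
    (f := (b + a.smulRight a).toLinearMap) hfinrank).1 hinj
  exact ⟨(LinearEquiv.ofBijective (b + a.smulRight a).toLinearMap
    ⟨hinj, hsurj⟩).toContinuousLinearEquiv, rfl⟩

theorem IsContactPair.flat_inverse_apply (h : IsContactPair a.toLinearMap b.toBilinForm)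
    (α : V →L[ℝ] ℝ) (w : V) :
    b ((b + a.smulRight a).inverse α) w + a ((b + a.smulRight a).inverse α) * a w = α w := by
  simpa using DFunLike.congr_fun (h.isInvertible_flat.self_apply_inverse (y := α)) w

theorem IsContactPair.eq_sharpLambda_iff (h : IsContactPair a.toLinearMap b.toBilinForm) {R : V}
    (haR : a R = 1) (hR : ∀ w, b R w = 0) (α : V →L[ℝ] ℝ) (u : V) :
    u = (b + a.smulRight a).inverse α - α R • R ↔ a u = 0 ∧ ∀ w, b u w = α w - α R * a w := by
  let s := (b + a.smulRight a).inverse α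
  have hs : ∀ w, b s w + a s * a w = α w := h.flat_inverse_apply α
  have has : a s = α R := by
    simpa [show b s R = 0 from h.apply_reeb hR s, haR] using hs R
  have ha : a (s - α R • R) = 0 := by simp [has, haR]
  have hb : ∀ w, b (s - α R • R) w = α w - α R * a w := fun w ↦ by simp [← hs w, has, hR]
  refine ⟨?_, fun hu ↦ h.ext (hu.1.trans ha.symm) fun w ↦ (hu.2 w).trans (hb w).symm⟩
  rintro rfl
  exact ⟨ha, hb⟩

end SharpLambda

section VectorSpaceForms

variable {E : Type*} [NormedAddCommGroup E] [NormedSpace ℝ E]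
  {F : Type*} [NormedAddCommGroup F] [NormedSpace ℝ F]
  {G : Type*} [NormedAddCommGroup G] [NormedSpace ℝ G]

/-- The exterior derivative `(u, v) ↦ D_u α (v) - D_v α (u)` of a vector-valued one-form on a
normed space, as a continuous bilinear map. -/
def bilinExtDeriv (α : E → E →L[ℝ] G) (y : E) : E →L[ℝ] E →L[ℝ] G :=
  fderiv ℝ α y - (fderiv ℝ α y).flip

theorem bilinExtDeriv_apply (α : E → E →L[ℝ] G) (y u v : E) :
    bilinExtDeriv α y u v = fderiv ℝ α y u v - fderiv ℝ α y v u := rfl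

theorem bilinExtDeriv_congr {α β : E → E →L[ℝ] G} {y : E} (h : α =ᶠ[𝓝 y] β) :
    bilinExtDeriv α y = bilinExtDeriv β y := by
  rw [bilinExtDeriv, bilinExtDeriv, h.fderiv_eq]

theorem contDiffAt_bilinExtDeriv {α : E → E →L[ℝ] G} {y : E} (hα : ContDiffAt ℝ ∞ α y) :
    ContDiffAt ℝ ∞ (bilinExtDeriv α) y := by
  have hd : ContDiffAt ℝ ∞ (fderiv ℝ α) y := hα.fderiv_right le_rfl
  have hflip : ContDiff ℝ ∞ fun b : E →L[ℝ] E →L[ℝ] G ↦ b.flip :=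
    IsBoundedLinearMap.contDiff ⟨⟨fun _ _ ↦ rfl, fun _ _ ↦ rfl⟩, 1, one_pos, fun b ↦ by simp⟩
  exact hd.sub (hflip.contDiffAt.comp y hd)

theorem bilinExtDeriv_pullback {ψ : F → E} {β : E → E →L[ℝ] G} {y : F}
    (hψ : ContDiffAt ℝ 2 ψ y) (hβ : DifferentiableAt ℝ β (ψ y)) (u v : F) :
    bilinExtDeriv (fun z ↦ (β (ψ z)).comp (fderiv ℝ ψ z)) y u v =
      bilinExtDeriv β (ψ y) (fderiv ℝ ψ y u) (fderiv ℝ ψ y v) := by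
  have hψ' : DifferentiableAt ℝ ψ y := hψ.differentiableAt (by simp)
  have hdψ : DifferentiableAt ℝ (fderiv ℝ ψ) y :=
    (hψ.fderiv_right (m := 1) (by norm_num)).differentiableAt (by simp)
  have hsymm : fderiv ℝ (fderiv ℝ ψ) y u v = fderiv ℝ (fderiv ℝ ψ) y v u :=
    hψ.isSymmSndFDerivAt (by simp) u v
  have hpull : fderiv ℝ (fun z ↦ (β (ψ z)).comp (fderiv ℝ ψ z)) y = _ :=
    ((hβ.hasFDerivAt.comp y hψ'.hasFDerivAt).clm_comp hdψ.hasFDerivAt).fderiv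
  rw [bilinExtDeriv_apply, hpull, bilinExtDeriv_apply]
  simp [hsymm]

end VectorSpaceForms

section Charts

variable {E : Type*} [NormedAddCommGroup E] [NormedSpace ℝ E]
  {H : Type*} [TopologicalSpace H] {I : ModelWithCorners ℝ E H}
  {M : Type*} [TopologicalSpace M] [ChartedSpace H M]
  {E' : Type*} [NormedAddCommGroup E'] [NormedSpace ℝ E']
  {F : Type*} [NormedAddCommGroup F] [NormedSpace ℝ F]
  {H' : Type*} [TopologicalSpace H'] {I' : ModelWithCorners ℝ E' H'}
  {M' : Type*} [TopologicalSpace M'] [ChartedSpace H' M']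

instance (x : M) : T2Space (TangentSpace I x) := inferInstanceAs (T2Space E)

instance [FiniteDimensional ℝ E] (x : M) : FiniteDimensional ℝ (TangentSpace I x) :=
  inferInstanceAs (FiniteDimensional ℝ E)

theorem OneForm.apply_congr (η : OneForm I M) {x y : M} (h : x = y) (v : E) :
    (η x : E →L[ℝ] ℝ) v = (η y : E →L[ℝ] ℝ) v := by
  rw [h]

theorem formInChart_extChartAt_mfderiv [IsManifold I 1 M] (η : OneForm I M) {x₀ x : M}
    (hx : x ∈ (extChartAt I x₀).source) (v : TangentSpace I x) :
    formInChart I η x₀ (extChartAt I x₀ x) (mfderiv I 𝓘(ℝ, E) (extChartAt I x₀) x v) = η x v := by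
  have hv := DFunLike.congr_fun
    (mfderivWithin_extChartAt_symm_comp_mfderiv_extChartAt' (I := I) hx) v
  exact (OneForm.apply_congr η ((extChartAt I x₀).left_inv hx) _).trans
    (congrArg (η x : E →L[ℝ] ℝ) hv)

theorem formInChart_self [IsManifold I 1 M] (η : OneForm I M) (x : M) (v : TangentSpace I x) :
    formInChart I η x (extChartAt I x x) v = η x v := by
  have h := formInChart_extChartAt_mfderiv η (mem_extChartAt_source (I := I) x) v
  rwa [mfderiv_extChartAt_self] at h

theorem trivializationAt_oneForm_snd [IsManifold I 1 M] (η : OneForm I M) {x₀ x : M}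
    (hx : x ∈ (extChartAt I x₀).source) :
    (trivializationAt (E →L[ℝ] ℝ) (fun x : M ↦ TangentSpace I x →L[ℝ] Bundle.Trivial M ℝ x) x₀
      ⟨x, η x⟩).2 = formInChart I η x₀ (extChartAt I x₀ x) := by
  have hsymm := TangentBundle.symmL_trivializationAt (𝕜 := ℝ) (I := I) (x₀ := x₀) (x := x)
    (by simpa using hx)
  rw [hom_trivializationAt_apply]
  ext v
  simp only [ContinuousLinearMap.inCoordinates, hsymm, Trivial.fiberBundle_trivializationAt',
    Trivial.continuousLinearMapAt_trivialization, ContinuousLinearMap.id_comp]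
  exact (OneForm.apply_congr η ((extChartAt I x₀).left_inv hx) _).symm

theorem isSmoothForm_of_contDiffAt_formInChart [IsManifold I ∞ M] {η : OneForm I M}
    (h : ∀ x, ContDiffAt ℝ ∞ (formInChart I η x) (extChartAt I x x)) : IsSmoothForm I η := by
  intro x
  refine ((trivializationAt (E →L[ℝ] ℝ)
    (fun x : M ↦ TangentSpace I x →L[ℝ] Bundle.Trivial M ℝ x) x).contMDiffAt_section_iff
      (by simp)).2 ?_
  refine ((h x).contMDiffAt.comp x contMDiffAt_extChartAt).congr_of_eventuallyEq ?_
  filter_upwards [extChartAt_source_mem_nhds (I := I) x] with z hz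
  exact trivializationAt_oneForm_snd η hz

theorem eventually_mdifferentiableAt_of_contMDiffAt [IsManifold I ∞ M] [IsManifold I' ∞ M']
    {f : M → M'} {x : M} (hf : ContMDiffAt I I' ∞ f x) : ∀ᶠ z in 𝓝 x, MDifferentiableAt I I' f z :=
  ((contMDiffAt_iff_contMDiffAt_nhds (n := 1) (by simp)).1 (hf.of_le (by simp))).mono
    fun _ hz ↦ hz.mdifferentiableAt (by simp)

theorem IsSmoothForm.isContactForm [IsManifold I 1 M] {η : OneForm I M}
    (hη : IsSmoothForm I η) {n : ℕ} (hn : Module.finrank ℝ E = 2 * n + 1)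
    (h : ∀ x, IsContactPair (η x).toLinearMap (extDerivForm I η x).toBilinForm) :
    IsContactForm I η :=
  ⟨hη, n, hn, fun x ↦ (h x).exists_wedgePow_ne_zero hn⟩

variable [I.Boundaryless]

theorem contMDiffAt_extChartAt_symm [IsManifold I ∞ M] {x₀ : M} {y : E}
    (hy : y ∈ (extChartAt I x₀).target) :
    ContMDiffAt 𝓘(ℝ, E) I ∞ (extChartAt I x₀).symm y :=
  (contMDiffOn_extChartAt_symm x₀).contMDiffAt ((isOpen_extChartAt_target x₀).mem_nhds hy)

theorem IsSmoothForm.contDiffAt_formInChart [IsManifold I ∞ M] {η : OneForm I M}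
    (hη : IsSmoothForm I η) {x₀ : M} {y : E} (hy : y ∈ (extChartAt I x₀).target) :
    ContDiffAt ℝ ∞ (formInChart I η x₀) y := by
  have hx := (extChartAt I x₀).map_target hy
  have hsnd := ((trivializationAt (E →L[ℝ] ℝ)
    (fun x : M ↦ TangentSpace I x →L[ℝ] Bundle.Trivial M ℝ x) x₀).contMDiffAt_section_iff
      (by simpa using hx)).1 (hη ((extChartAt I x₀).symm y))
  refine (hsnd.comp y (contMDiffAt_extChartAt_symm hy)).contDiffAt.congr_of_eventuallyEq ?_
  filter_upwards [(isOpen_extChartAt_target x₀).mem_nhds hy] with z hz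
  rw [Function.comp_apply, trivializationAt_oneForm_snd η ((extChartAt I x₀).map_target hz),
    (extChartAt I x₀).right_inv hz]

theorem extDerivForm_eq_bilinExtDeriv [IsManifold I 1 M] (η : OneForm I M) (x : M)
    (u v : TangentSpace I x) :
    extDerivForm I η x u v = bilinExtDeriv (formInChart I η x) (extChartAt I x x) u v := by
  simp only [extDerivForm, extDerivInChart, I.range_eq_univ, fderivWithin_univ,
    mfderiv_extChartAt_self]
  rfl

theorem isAlt_extDerivForm [IsManifold I 1 M] (η : OneForm I M) (x : M) :
    (extDerivForm I η x).toBilinForm.IsAlt := fun v ↦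
  (extDerivForm_eq_bilinExtDeriv η x v v).trans (sub_self _)

theorem formInChart_eventuallyEq [IsManifold I ∞ M] {η : OneForm I M} {x : M}
    {α : E → E →L[ℝ] ℝ} (h : ∀ᶠ z in 𝓝 x, ∀ v : TangentSpace I z,
      η z v = α (extChartAt I x z) (mfderiv I 𝓘(ℝ, E) (extChartAt I x) z v)) :
    formInChart I η x =ᶠ[𝓝 (extChartAt I x x)] α := by
  have htendsto := (continuousAt_extChartAt_symm (I := I) x).tendsto
  rw [extChartAt_to_inv] at htendsto
  filter_upwards [htendsto.eventually h, extChartAt_target_mem_nhds x] with y hy hyt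
  ext u
  have hu := DFunLike.congr_fun
    (mfderiv_extChartAt_comp_mfderivWithin_extChartAt_symm (I := I) hyt) u
  refine (hy (mfderivWithin 𝓘(ℝ, E) I (extChartAt I x).symm (range I) y u)).trans ?_
  rw [(extChartAt I x).right_inv hyt]
  exact congrArg (α y) hu

theorem fderiv_comp_extChartAt_symm_mfderiv [IsManifold I 1 M] {f : M → F} {x z : M}
    (hz : z ∈ (extChartAt I x).source) (hf : MDifferentiableAt I 𝓘(ℝ, F) f z)
    (v : TangentSpace I z) :
    fderiv ℝ (f ∘ (extChartAt I x).symm) (extChartAt I x z)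
      (mfderiv I 𝓘(ℝ, E) (extChartAt I x) z v) = mfderiv I 𝓘(ℝ, F) f z v := by
  have hφ := mdifferentiableAt_extChartAt (I := I) (x := x) (by simpa using hz)
  have hsymm : MDifferentiableAt 𝓘(ℝ, E) I (extChartAt I x).symm (extChartAt I x z) := by
    simpa [I.range_eq_univ, mdifferentiableWithinAt_univ] using
      mdifferentiableWithinAt_extChartAt_symm (I := I) ((extChartAt I x).map_source hz)
  have hψ : MDifferentiableAt 𝓘(ℝ, E) 𝓘(ℝ, F) (f ∘ (extChartAt I x).symm) (extChartAt I x z) := by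
    refine MDifferentiableAt.comp _ ?_ hsymm
    rwa [(extChartAt I x).left_inv hz]
  have heq : (f ∘ (extChartAt I x).symm) ∘ extChartAt I x =ᶠ[𝓝 z] f := by
    filter_upwards [(isOpen_extChartAt_source x).mem_nhds hz] with w hw
    simp only [Function.comp_apply, (extChartAt I x).left_inv hw]
  have hd := DFunLike.congr_fun ((mfderiv_comp z hψ hφ).symm.trans heq.mfderiv_eq) v
  rwa [mfderiv_eq_fderiv] at hd

variable [IsManifold I ∞ M]

theorem extDerivForm_eq_of_eventually_eq_pullback {θ : OneForm I M} {f : M → F}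
    {β : F → F →L[ℝ] ℝ} {x : M} (hf : ContMDiffAt I 𝓘(ℝ, F) ∞ f x)
    (hβ : DifferentiableAt ℝ β (f x))
    (h : ∀ᶠ z in 𝓝 x, ∀ v : TangentSpace I z, θ z v = β (f z) (mfderiv I 𝓘(ℝ, F) f z v))
    (u v : TangentSpace I x) :
    extDerivForm I θ x u v =
      bilinExtDeriv β (f x) (mfderiv I 𝓘(ℝ, F) f x u) (mfderiv I 𝓘(ℝ, F) f x v) := by
  set ψ := f ∘ (extChartAt I x).symm
  have hψ : ContDiffAt ℝ ∞ ψ (extChartAt I x x) := by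
    have h := (contMDiffAt_iff.1 hf).2
    rwa [I.range_eq_univ, contDiffWithinAt_univ] at h
  have hψx : ψ (extChartAt I x x) = f x := by simp only [ψ, Function.comp_apply, extChartAt_to_inv]
  have hloc : formInChart I θ x =ᶠ[𝓝 (extChartAt I x x)]
      fun y ↦ (β (ψ y)).comp (fderiv ℝ ψ y) := by
    refine formInChart_eventuallyEq ?_
    filter_upwards [h, eventually_mdifferentiableAt_of_contMDiffAt hf,
      extChartAt_source_mem_nhds (I := I) x] with z hz hzd hzx v
    rw [hz, ← fderiv_comp_extChartAt_symm_mfderiv hzx hzd]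
    simp only [ψ, Function.comp_apply, (extChartAt I x).left_inv hzx]
    rfl
  have hderiv (w : TangentSpace I x) :
      fderiv ℝ ψ (extChartAt I x x) w = mfderiv I 𝓘(ℝ, F) f x w := by
    have hw := fderiv_comp_extChartAt_symm_mfderiv (mem_extChartAt_source x)
      (hf.mdifferentiableAt (by simp)) w
    rwa [mfderiv_extChartAt_self] at hw
  rw [extDerivForm_eq_bilinExtDeriv, bilinExtDeriv_congr hloc]
  refine (bilinExtDeriv_pullback (hψ.of_le ENat.LEInfty.out) (hψx ▸ hβ) u v).trans ?_
  rw [hderiv, hderiv, hψx]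

theorem IsSmoothForm.extDerivForm_eq_bilinExtDeriv_formInChart {η : OneForm I M}
    (hη : IsSmoothForm I η) {x₀ x : M} (hx : x ∈ (extChartAt I x₀).source)
    (u v : TangentSpace I x) :
    extDerivForm I η x u v = bilinExtDeriv (formInChart I η x₀) (extChartAt I x₀ x)
      (mfderiv I 𝓘(ℝ, E) (extChartAt I x₀) x u) (mfderiv I 𝓘(ℝ, E) (extChartAt I x₀) x v) := by
  refine extDerivForm_eq_of_eventually_eq_pullback
    (contMDiffAt_extChartAt' (by simpa using hx))
    ((hη.contDiffAt_formInChart ((extChartAt I x₀).map_source hx)).differentiableAt (by simp))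
    ?_ u v
  filter_upwards [(isOpen_extChartAt_source x₀).mem_nhds hx] with z hz w
  exact (formInChart_extChartAt_mfderiv η hz w).symm

theorem IsSmoothForm.extDerivForm_pullback [IsManifold I' ∞ M'] [I'.Boundaryless]
    {η : OneForm I' M'} (hη : IsSmoothForm I' η) {θ : OneForm I M} {f : M → M'}
    {x : M} (hf : ContMDiffAt I I' ∞ f x)
    (h : ∀ᶠ z in 𝓝 x, ∀ v : TangentSpace I z, θ z v = η (f z) (mfderiv I I' f z v))
    (u v : TangentSpace I x) :
    extDerivForm I θ x u v =
      extDerivForm I' η (f x) (mfderiv I I' f x u) (mfderiv I I' f x v) := by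
  have hcomp {z : M} (hz : f z ∈ (extChartAt I' (f x)).source) (hzd : MDifferentiableAt I I' f z)
      (w : TangentSpace I z) : mfderiv I 𝓘(ℝ, E') (extChartAt I' (f x) ∘ f) z w =
        mfderiv I' 𝓘(ℝ, E') (extChartAt I' (f x)) (f z) (mfderiv I I' f z w) :=
    mfderiv_comp_apply z (mdifferentiableAt_extChartAt (by simpa using hz)) hzd w
  have hx : f x ∈ (extChartAt I' (f x)).source := mem_extChartAt_source (f x)
  have hfx := hf.mdifferentiableAt (by simp)
  have hβ := (hη.contDiffAt_formInChart (mem_extChartAt_target (f x))).differentiableAt (by simp)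
  rw [hη.extDerivForm_eq_bilinExtDeriv_formInChart hx, ← hcomp hx hfx, ← hcomp hx hfx]
  refine extDerivForm_eq_of_eventually_eq_pullback (contMDiffAt_extChartAt.comp x hf) hβ ?_ u v
  filter_upwards [h, eventually_mdifferentiableAt_of_contMDiffAt hf,
    hf.continuousAt.preimage_mem_nhds (extChartAt_source_mem_nhds (I := I') (f x))]
    with z hz hzd hzs w
  rw [hz, hcomp hzs hzd]
  exact (formInChart_extChartAt_mfderiv η hzs _).symm

theorem IsContactForm.isContactPair {η : OneForm I M} (hη : IsContactForm I η) (x : M) :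
    IsContactPair (η x).toLinearMap (extDerivForm I η x).toBilinForm := by
  obtain ⟨-, n, hn, hv⟩ := hη
  obtain ⟨v, hv⟩ := hv x
  exact .of_wedgePow_ne_zero (isAlt_extDerivForm η x) hn hv

end Charts

section ModelExtendedForm

variable {E : Type*} [NormedAddCommGroup E] [NormedSpace ℝ E]

/-- The one-form `α^c + t α^v` on `(E × E) × ℝ`, for a one-form `α` on the normed space `E`. A point
is written `((x, ẋ), t)`. -/
def modelExtendedForm (α : E → E →L[ℝ] ℝ) (y : (E × E) × ℝ) : (E × E) × ℝ →L[ℝ] ℝ :=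
  (fderiv ℝ α y.1.1 y.1.2 + y.2 • α y.1.1).comp
      ((ContinuousLinearMap.fst ℝ E E).comp (ContinuousLinearMap.fst ℝ (E × E) ℝ)) +
    (α y.1.1).comp ((ContinuousLinearMap.snd ℝ E E).comp (ContinuousLinearMap.fst ℝ (E × E) ℝ))

theorem modelExtendedForm_apply (α : E → E →L[ℝ] ℝ) (y u : (E × E) × ℝ) :
    modelExtendedForm α y u =
      (fderiv ℝ α y.1.1 y.1.2 + y.2 • α y.1.1) u.1.1 + α y.1.1 u.1.2 := rfl

variable {α : E → E →L[ℝ] ℝ} {y : (E × E) × ℝ}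

theorem hasFDerivAt_apply_snd (hα : DifferentiableAt ℝ α y.1.1) :
    HasFDerivAt (fun z : (E × E) × ℝ ↦ α z.1.1 z.1.2)
      ((fderiv ℝ α y.1.1).flip y.1.2 ∘L
          ((ContinuousLinearMap.fst ℝ E E).comp (ContinuousLinearMap.fst ℝ (E × E) ℝ)) +
        α y.1.1 ∘L ((ContinuousLinearMap.snd ℝ E E).comp (ContinuousLinearMap.fst ℝ (E × E) ℝ)))
      y := by
  have hx : HasFDerivAt (fun z : (E × E) × ℝ ↦ z.1.1) _ y :=
    ((ContinuousLinearMap.fst ℝ E E).comp (ContinuousLinearMap.fst ℝ (E × E) ℝ)).hasFDerivAt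
  have hv : HasFDerivAt (fun z : (E × E) × ℝ ↦ z.1.2) _ y :=
    ((ContinuousLinearMap.snd ℝ E E).comp (ContinuousLinearMap.fst ℝ (E × E) ℝ)).hasFDerivAt
  exact ((HasFDerivAt.comp (g := α) y hα.hasFDerivAt hx).clm_apply hv).congr_fderiv (add_comm _ _)

theorem modelExtendedForm_eq_add (hα : DifferentiableAt ℝ α y.1.1) (u : (E × E) × ℝ) :
    modelExtendedForm α y u = fderiv ℝ (fun z : (E × E) × ℝ ↦ α z.1.1 z.1.2) y u +
      bilinExtDeriv α y.1.1 y.1.2 u.1.1 + y.2 * α y.1.1 u.1.1 := by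
  rw [(hasFDerivAt_apply_snd hα).fderiv, modelExtendedForm_apply, bilinExtDeriv_apply]
  simp only [add_apply, smul_apply, smul_eq_mul, ContinuousLinearMap.comp_apply,
    ContinuousLinearMap.coe_fst', ContinuousLinearMap.flip_apply, ContinuousLinearMap.coe_snd']
  ring

theorem contDiffAt_modelExtendedForm (hα : ContDiffAt ℝ ∞ α y.1.1) :
    ContDiffAt ℝ ∞ (modelExtendedForm α) y := by
  have hx : ContDiffAt ℝ ∞ (fun z : (E × E) × ℝ ↦ z.1.1) y := contDiffAt_fst.fst
  have hαx : ContDiffAt ℝ ∞ (fun z : (E × E) × ℝ ↦ α z.1.1) y := hα.comp y hx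
  have hdαx : ContDiffAt ℝ ∞ (fun z : (E × E) × ℝ ↦ fderiv ℝ α z.1.1) y :=
    (hα.fderiv_right (m := ∞) le_rfl).comp y hx
  have hl := (hdαx.clm_apply contDiffAt_fst.snd).add (contDiffAt_snd.smul hαx)
  exact (hl.clm_comp contDiffAt_const).add (hαx.clm_comp contDiffAt_const)

theorem fderiv_modelExtendedForm (hα : ContDiffAt ℝ ∞ α y.1.1) (u w : (E × E) × ℝ) :
    fderiv ℝ (modelExtendedForm α) y u w = fderiv ℝ (fderiv ℝ α) y.1.1 u.1.1 y.1.2 w.1.1 +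
      fderiv ℝ α y.1.1 u.1.2 w.1.1 + u.2 * α y.1.1 w.1.1 + y.2 * fderiv ℝ α y.1.1 u.1.1 w.1.1 +
      fderiv ℝ α y.1.1 u.1.1 w.1.2 := by
  have hx : HasFDerivAt (fun z : (E × E) × ℝ ↦ z.1.1) _ y :=
    ((ContinuousLinearMap.fst ℝ E E).comp (ContinuousLinearMap.fst ℝ (E × E) ℝ)).hasFDerivAt
  have hv : HasFDerivAt (fun z : (E × E) × ℝ ↦ z.1.2) _ y :=
    ((ContinuousLinearMap.snd ℝ E E).comp (ContinuousLinearMap.fst ℝ (E × E) ℝ)).hasFDerivAt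
  have hαx : HasFDerivAt (fun z : (E × E) × ℝ ↦ α z.1.1) _ y :=
    (hα.differentiableAt (by simp)).hasFDerivAt.comp y hx
  have hd : DifferentiableAt ℝ (fderiv ℝ α) y.1.1 :=
    (hα.fderiv_right (m := ∞) le_rfl).differentiableAt (by simp)
  have hdαx : HasFDerivAt (fun z : (E × E) × ℝ ↦ fderiv ℝ α z.1.1) _ y :=
    HasFDerivAt.comp (g := fderiv ℝ α) y hd.hasFDerivAt hx
  have hl := (hdαx.clm_apply hv).add ((hasFDerivAt_snd (p := y)).smul hαx)
  have happly := (hl.clm_apply (hasFDerivAt_const w.1.1 y)).add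
    (hαx.clm_apply (hasFDerivAt_const w.1.2 y))
  have hform := ((contDiffAt_modelExtendedForm hα).differentiableAt (by simp)).hasFDerivAt.clm_apply
    (hasFDerivAt_const w y)
  have h := DFunLike.congr_fun (hform.unique happly) u
  simp only [ContinuousLinearMap.comp_zero, zero_add, ContinuousLinearMap.flip_apply, Pi.add_apply,
    Pi.smul_apply', ContinuousLinearMap.flip_add, ContinuousLinearMap.flip_smul, add_apply,
    smul_apply, ContinuousLinearMap.comp_apply, ContinuousLinearMap.coe_fst',
    ContinuousLinearMap.coe_snd', smul_eq_mul, ContinuousLinearMap.smulRight_apply] at h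
  rw [h]
  ring

theorem bilinExtDeriv_modelExtendedForm (hα : ContDiffAt ℝ ∞ α y.1.1) (u w : (E × E) × ℝ) :
    bilinExtDeriv (modelExtendedForm α) y u w =
      (bilinExtDeriv (fun z ↦ fderiv ℝ α z y.1.2) y.1.1 u.1.1 w.1.1 +
        y.2 * bilinExtDeriv α y.1.1 u.1.1 w.1.1) +
      bilinExtDeriv α y.1.1 u.1.2 w.1.1 + bilinExtDeriv α y.1.1 u.1.1 w.1.2 +
      u.2 * α y.1.1 w.1.1 - w.2 * α y.1.1 u.1.1 := by
  have hd : DifferentiableAt ℝ (fderiv ℝ α) y.1.1 :=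
    (hα.fderiv_right (m := ∞) le_rfl).differentiableAt (by simp)
  have hdapply : fderiv ℝ (fun z ↦ fderiv ℝ α z y.1.2) y.1.1 = _ :=
    (hd.hasFDerivAt.clm_apply (hasFDerivAt_const y.1.2 y.1.1)).fderiv
  simp only [bilinExtDeriv_apply, fderiv_modelExtendedForm hα, hdapply,
    ContinuousLinearMap.comp_zero, zero_add, ContinuousLinearMap.flip_apply]
  ring

end ModelExtendedForm

section ExtendedForm

variable {E : Type*} [NormedAddCommGroup E] [NormedSpace ℝ E]
  {H : Type*} [TopologicalSpace H] {I : ModelWithCorners ℝ E H}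
  {M : Type*} [TopologicalSpace M] [ChartedSpace H M]
  {E' : Type*} [NormedAddCommGroup E'] [NormedSpace ℝ E']
  {H' : Type*} [TopologicalSpace H'] {I' : ModelWithCorners ℝ E' H'}
  {N : Type*} [TopologicalSpace N] [ChartedSpace H' N]

theorem trivializationAt_tangent_snd [IsManifold I 1 M] {x₀ x : M}
    (hx : x ∈ (extChartAt I x₀).source) (w : TangentSpace I x) :
    (trivializationAt E (TangentSpace I : M → Type _) x₀ ⟨x, w⟩).2 =
      mfderiv I 𝓘(ℝ, E) (extChartAt I x₀) x w := by
  have hlin := TangentBundle.continuousLinearMapAt_trivializationAt (𝕜 := ℝ) (I := I)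
    (show x ∈ (chartAt H x₀).source by simpa using hx)
  refine Eq.trans ?_ (DFunLike.congr_fun hlin w)
  exact (congrFun (Trivialization.coe_linearMapAt_of_mem
    (trivializationAt E (TangentSpace I : M → Type _) x₀) (by simpa using hx)) w).symm

theorem extChartAt_tangentBundle_prod_source [IsManifold I 1 M] (p : TangentBundle I M × ℝ) :
    (extChartAt (I.tangent.prod 𝓘(ℝ, ℝ)) p).source =
      {q | q.1.proj ∈ (extChartAt I p.1.proj).source} := by
  ext q
  rw [extChartAt_prod, PartialEquiv.prod_source, extChartAt_source 𝓘(ℝ, ℝ), chartAt_self_eq]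
  simp [TangentBundle.mem_chart_source_iff]

theorem extChartAt_tangentBundle_prod_apply [IsManifold I 1 M] {p q : TangentBundle I M × ℝ}
    (hq : q.1.proj ∈ (extChartAt I p.1.proj).source) :
    extChartAt (I.tangent.prod 𝓘(ℝ, ℝ)) p q = ((extChartAt I p.1.proj q.1.proj,
      mfderiv I 𝓘(ℝ, E) (extChartAt I p.1.proj) q.1.proj q.1.snd), q.2) := by
  have hfst : extChartAt (I.prod 𝓘(ℝ, E)) p.1 q.1 = (extChartAt I p.1.proj q.1.proj,
      (trivializationAt E (TangentSpace I : M → Type _) p.1.proj q.1).2) := by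
    rw [FiberBundle.extChartAt]
    simp
  rw [← trivializationAt_tangent_snd hq, extChartAt_prod]
  exact Prod.ext hfst rfl

variable [IsManifold I ∞ M]

theorem mdifferentiableAt_tangentBundle_proj (v : TangentBundle I M) :
    MDifferentiableAt I.tangent I (fun w : TangentBundle I M ↦ w.proj) v :=
  (contMDiffAt_proj (n := 1) (TangentSpace I : M → Type _)).mdifferentiableAt (by simp)

theorem IsSmoothForm.contMDiffAt_apply {η : OneForm I M} (hη : IsSmoothForm I η)
    {v : N → TangentBundle I M} {z : N} (hv : ContMDiffAt I' I.tangent ∞ v z) :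
    ContMDiffAt I' 𝓘(ℝ, ℝ) ∞ (fun z ↦ η (v z).proj (v z).snd) z := by
  have hproj : ContMDiffAt I' I ∞ (fun z ↦ (v z).proj) z :=
    (contMDiff_proj (TangentSpace I : M → Type _)).contMDiffAt.comp z hv
  have h := ContMDiffAt.clm_bundle_apply (F₁ := E) (E₁ := (TangentSpace I : M → Type _))
    (F₂ := ℝ) (E₂ := Bundle.Trivial M ℝ) (b := fun z ↦ (v z).proj)
    (ϕ := fun z ↦ η (v z).proj) (v := fun z ↦ (v z).snd) (hη.contMDiffAt.comp z hproj) hv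
  exact (contMDiffAt_totalSpace.1 h).2

theorem IsSmoothForm.extendedForm_mfderiv {η : OneForm I M} (hη : IsSmoothForm I η)
    {f : N → TangentBundle I M × ℝ} {z : N}
    (hf : MDifferentiableAt I' (I.tangent.prod 𝓘(ℝ, ℝ)) f z) (w : TangentSpace I' z) :
    extendedForm I η (f z) (mfderiv I' (I.tangent.prod 𝓘(ℝ, ℝ)) f z w) =
      mvfderiv I' (fun z ↦ η (f z).1.proj (f z).1.snd) z w +
        extDerivForm I η (f z).1.proj (f z).1.snd (mfderiv I' I (fun z ↦ (f z).1.proj) z w) +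
        (f z).2 * η (f z).1.proj (mfderiv I' I (fun z ↦ (f z).1.proj) z w) := by
  have hf₁ : MDifferentiableAt I' I.tangent (fun z ↦ (f z).1) z := hf.fst
  have hfst : mfderiv I' I.tangent (fun z ↦ (f z).1) z w = _ :=
    mfderiv_comp_apply z mdifferentiableAt_fst hf w
  have hproj : mfderiv I' I (fun z ↦ (f z).1.proj) z w = _ :=
    mfderiv_comp_apply z (mdifferentiableAt_tangentBundle_proj (f z).1) hf₁ w
  have heval : mvfderiv I' (fun z ↦ η (f z).1.proj (f z).1.snd) z w =
      mvfderiv I.tangent (fun v : TangentBundle I M ↦ η v.proj v.snd) (f z).1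
        (mfderiv I' I.tangent (fun z ↦ (f z).1) z w) :=
    mvfderiv_comp_apply z (g := fun v : TangentBundle I M ↦ η v.proj v.snd)
      ((hη.contMDiffAt_apply contMDiffAt_id).mdifferentiableAt (by simp)) hf₁ w
  rw [heval, hproj, hfst]
  rfl

theorem eventually_proj_mem_extChartAt_source {p q : TangentBundle I M × ℝ}
    (hq : q.1.proj ∈ (extChartAt I p.1.proj).source) :
    ∀ᶠ q' : TangentBundle I M × ℝ in 𝓝 q, q'.1.proj ∈ (extChartAt I p.1.proj).source := by
  have h := (isOpen_extChartAt_source (I := I.tangent.prod 𝓘(ℝ, ℝ)) p).mem_nhds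
    (by rwa [extChartAt_tangentBundle_prod_source] : q ∈ _)
  rwa [extChartAt_tangentBundle_prod_source] at h

theorem mdifferentiableAt_extChartAt_tangentBundle_prod {p q : TangentBundle I M × ℝ}
    (hq : q.1.proj ∈ (extChartAt I p.1.proj).source) :
    MDifferentiableAt (I.tangent.prod 𝓘(ℝ, ℝ)) 𝓘(ℝ, (E × E) × ℝ)
      (extChartAt (I.tangent.prod 𝓘(ℝ, ℝ)) p) q := by
  have hqΦ : q ∈ (extChartAt (I.tangent.prod 𝓘(ℝ, ℝ)) p).source := by
    rwa [extChartAt_tangentBundle_prod_source]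
  exact (contMDiffAt_extChartAt' (n := 1) (by rwa [extChartAt_source] at hqΦ)).mdifferentiableAt
    (by simp)

theorem mfderiv_extChartAt_tangentBundle_prod_fst_fst {p q : TangentBundle I M × ℝ}
    (hq : q.1.proj ∈ (extChartAt I p.1.proj).source)
    (ξ : TangentSpace (I.tangent.prod 𝓘(ℝ, ℝ)) q) :
    (mfderiv (I.tangent.prod 𝓘(ℝ, ℝ)) 𝓘(ℝ, (E × E) × ℝ)
      (extChartAt (I.tangent.prod 𝓘(ℝ, ℝ)) p) q ξ : (E × E) × ℝ).1.1 =
      mfderiv I 𝓘(ℝ, E) (extChartAt I p.1.proj) q.1.proj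
        (mfderiv (I.tangent.prod 𝓘(ℝ, ℝ)) I
          (fun q' : TangentBundle I M × ℝ ↦ q'.1.proj) q ξ) := by
  have hx : HasFDerivAt (fun y : (E × E) × ℝ ↦ y.1.1) _
      (extChartAt (I.tangent.prod 𝓘(ℝ, ℝ)) p q) :=
    ((ContinuousLinearMap.fst ℝ E E).comp (ContinuousLinearMap.fst ℝ (E × E) ℝ)).hasFDerivAt
  have heq : extChartAt I p.1.proj ∘ (fun q' : TangentBundle I M × ℝ ↦ q'.1.proj) =ᶠ[𝓝 q]
      (fun y : (E × E) × ℝ ↦ y.1.1) ∘ extChartAt (I.tangent.prod 𝓘(ℝ, ℝ)) p := by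
    filter_upwards [eventually_proj_mem_extChartAt_source hq] with q' hq'
    rw [Function.comp_apply, Function.comp_apply, extChartAt_tangentBundle_prod_apply hq']
  have hproj : MDifferentiableAt (I.tangent.prod 𝓘(ℝ, ℝ)) I
      (fun q' : TangentBundle I M × ℝ ↦ q'.1.proj) q :=
    (mdifferentiableAt_tangentBundle_proj q.1).comp q mdifferentiableAt_fst
  have hleft := mfderiv_comp_apply q
    (mdifferentiableAt_extChartAt (by rwa [extChartAt_source] at hq)) hproj ξ
  have hright := mfderiv_comp_apply q hx.hasMFDerivAt.mdifferentiableAt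
    (mdifferentiableAt_extChartAt_tangentBundle_prod hq) ξ
  rw [mfderiv_eq_fderiv, hx.fderiv] at hright
  exact hright.symm.trans ((DFunLike.congr_fun heq.mfderiv_eq ξ).symm.trans hleft)

variable [I.Boundaryless]

theorem IsSmoothForm.mvfderiv_apply_snd {η : OneForm I M} (hη : IsSmoothForm I η)
    {p q : TangentBundle I M × ℝ} (hq : q.1.proj ∈ (extChartAt I p.1.proj).source)
    (ξ : TangentSpace (I.tangent.prod 𝓘(ℝ, ℝ)) q) :
    mvfderiv (I.tangent.prod 𝓘(ℝ, ℝ))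
      (fun q' : TangentBundle I M × ℝ ↦ η q'.1.proj q'.1.snd) q ξ =
      fderiv ℝ (fun y : (E × E) × ℝ ↦ formInChart I η p.1.proj y.1.1 y.1.2)
        (extChartAt (I.tangent.prod 𝓘(ℝ, ℝ)) p q)
        (mfderiv (I.tangent.prod 𝓘(ℝ, ℝ)) 𝓘(ℝ, (E × E) × ℝ)
          (extChartAt (I.tangent.prod 𝓘(ℝ, ℝ)) p) q ξ) := by
  have heq : (fun q' : TangentBundle I M × ℝ ↦ η q'.1.proj q'.1.snd) =ᶠ[𝓝 q]
      (fun y : (E × E) × ℝ ↦ formInChart I η p.1.proj y.1.1 y.1.2) ∘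
        extChartAt (I.tangent.prod 𝓘(ℝ, ℝ)) p := by
    filter_upwards [eventually_proj_mem_extChartAt_source hq] with q' hq'
    rw [Function.comp_apply, extChartAt_tangentBundle_prod_apply hq']
    exact (formInChart_extChartAt_mfderiv η hq' _).symm
  have hα : DifferentiableAt ℝ (formInChart I η p.1.proj)
      (extChartAt (I.tangent.prod 𝓘(ℝ, ℝ)) p q).1.1 := by
    rw [extChartAt_tangentBundle_prod_apply hq]
    exact (hη.contDiffAt_formInChart ((extChartAt I p.1.proj).map_source hq)).differentiableAt
      (by simp)
  have h := mfderiv_comp_apply q (hasFDerivAt_apply_snd hα).hasMFDerivAt.mdifferentiableAt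
    (mdifferentiableAt_extChartAt_tangentBundle_prod hq) ξ
  rw [mfderiv_eq_fderiv] at h
  exact (DFunLike.congr_fun heq.mfderiv_eq ξ).trans h

theorem IsSmoothForm.extendedForm_eq_modelExtendedForm {η : OneForm I M} (hη : IsSmoothForm I η)
    {p q : TangentBundle I M × ℝ} (hq : q.1.proj ∈ (extChartAt I p.1.proj).source)
    (ξ : TangentSpace (I.tangent.prod 𝓘(ℝ, ℝ)) q) :
    extendedForm I η q ξ = modelExtendedForm (formInChart I η p.1.proj)
      (extChartAt (I.tangent.prod 𝓘(ℝ, ℝ)) p q)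
      (mfderiv (I.tangent.prod 𝓘(ℝ, ℝ)) 𝓘(ℝ, (E × E) × ℝ)
        (extChartAt (I.tangent.prod 𝓘(ℝ, ℝ)) p) q ξ) := by
  have hα : DifferentiableAt ℝ (formInChart I η p.1.proj) (extChartAt I p.1.proj q.1.proj) :=
    (hη.contDiffAt_formInChart ((extChartAt I p.1.proj).map_source hq)).differentiableAt (by simp)
  have hform := hη.extendedForm_mfderiv mdifferentiableAt_id ξ
  rw [mfderiv_id] at hform
  refine hform.trans ?_
  have hfst := mfderiv_extChartAt_tangentBundle_prod_fst_fst hq ξ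
  have hΦ := extChartAt_tangentBundle_prod_apply hq
  have hbase := congrArg (fun y ↦ y.1.1) hΦ
  have hfibre := congrArg (fun y ↦ y.1.2) hΦ
  refine Eq.trans ?_ (modelExtendedForm_eq_add (by rwa [hΦ]) _).symm
  refine congrArg₂ (· + ·) (congrArg₂ (· + ·) ?_ ?_) (congrArg _ ?_)
  · exact hη.mvfderiv_apply_snd hq ξ
  · refine (hη.extDerivForm_eq_bilinExtDeriv_formInChart hq _ _).trans ?_
    rw [hfst, hbase, hfibre]
    rfl
  · refine (formInChart_extChartAt_mfderiv η hq _).symm.trans ?_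
    rw [hfst, hbase]
    rfl

end ExtendedForm

section ContactExtension

variable {E : Type*} [NormedAddCommGroup E] [NormedSpace ℝ E]
  {H : Type*} [TopologicalSpace H] {I : ModelWithCorners ℝ E H}
  {M : Type*} [TopologicalSpace M] [ChartedSpace H M]

theorem isContactPair_modelExtendedForm {α : E → E →L[ℝ] ℝ} {y : (E × E) × ℝ}
    (hα : ContDiffAt ℝ ∞ α y.1.1)
    (h : IsContactPair (α y.1.1).toLinearMap (bilinExtDeriv α y.1.1).toBilinForm) :
    IsContactPair (modelExtendedForm α y).toLinearMap
      (bilinExtDeriv (modelExtendedForm α) y).toBilinForm := by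
  have hs : (bilinExtDeriv (fun z ↦ fderiv ℝ α z y.1.2) y.1.1 +
      y.2 • bilinExtDeriv α y.1.1).toBilinForm.IsAlt := fun u ↦ by
    simp [bilinExtDeriv_apply]
  exact h.tangentLift (fderiv ℝ α y.1.1 y.1.2 + y.2 • α y.1.1).toLinearMap hs
    (modelExtendedForm_apply α y) (bilinExtDeriv_modelExtendedForm hα)

theorem isContactPair_iff_formInChart [I.Boundaryless] [IsManifold I 1 M] (η : OneForm I M)
    (x : M) :
    IsContactPair (η x).toLinearMap (extDerivForm I η x).toBilinForm ↔
      IsContactPair (formInChart I η x (extChartAt I x x)).toLinearMap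
        (bilinExtDeriv (formInChart I η x) (extChartAt I x x)).toBilinForm := by
  have hη : formInChart I η x (extChartAt I x x) = η x :=
    ContinuousLinearMap.ext (formInChart_self η x)
  have hdη : extDerivForm I η x = bilinExtDeriv (formInChart I η x) (extChartAt I x x) :=
    ContinuousLinearMap.ext fun u ↦ ContinuousLinearMap.ext (extDerivForm_eq_bilinExtDeriv η x u)
  rw [hη, ← hdη]
  rfl

variable [IsManifold I ∞ M] [I.Boundaryless] {η : OneForm I M}

theorem IsSmoothForm.formInChart_extendedForm_eventuallyEq (hη : IsSmoothForm I η)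
    (p : TangentBundle I M × ℝ) :
    formInChart (I.tangent.prod 𝓘(ℝ, ℝ)) (extendedForm I η) p
      =ᶠ[𝓝 (extChartAt (I.tangent.prod 𝓘(ℝ, ℝ)) p p)]
        modelExtendedForm (formInChart I η p.1.proj) := by
  refine formInChart_eventuallyEq ?_
  filter_upwards [eventually_proj_mem_extChartAt_source
    (mem_extChartAt_source (I := I) p.1.proj)] with q hq ξ
  exact hη.extendedForm_eq_modelExtendedForm hq ξ

protected theorem IsSmoothForm.extendedForm (hη : IsSmoothForm I η) :
    IsSmoothForm (I.tangent.prod 𝓘(ℝ, ℝ)) (extendedForm I η) := by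
  refine isSmoothForm_of_contDiffAt_formInChart fun p ↦
    ContDiffAt.congr_of_eventuallyEq (contDiffAt_modelExtendedForm ?_)
      (hη.formInChart_extendedForm_eventuallyEq p)
  rw [extChartAt_tangentBundle_prod_apply (mem_extChartAt_source (I := I) p.1.proj)]
  exact hη.contDiffAt_formInChart (mem_extChartAt_target _)

protected theorem IsContactForm.extendedForm (hη : IsContactForm I η) :
    IsContactForm (I.tangent.prod 𝓘(ℝ, ℝ)) (extendedForm I η) := by
  obtain ⟨n, hn, -⟩ := hη.2
  have : FiniteDimensional ℝ E := Module.finite_of_finrank_pos (by omega)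
  refine hη.1.extendedForm.isContactForm (n := 2 * n + 1)
    (by rw [Module.finrank_prod, Module.finrank_prod, Module.finrank_self, hn]; ring) fun p ↦ ?_
  have hbase : (extChartAt (I.tangent.prod 𝓘(ℝ, ℝ)) p p).1.1 = extChartAt I p.1.proj p.1.proj :=
    congrArg (fun z ↦ z.1.1)
      (extChartAt_tangentBundle_prod_apply (mem_extChartAt_source (I := I) p.1.proj))
  have hform := hη.1.formInChart_extendedForm_eventuallyEq p
  rw [isContactPair_iff_formInChart, hform.self_of_nhds, bilinExtDeriv_congr hform]
  refine isContactPair_modelExtendedForm ?_ ?_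
  · exact hbase ▸ hη.1.contDiffAt_formInChart (mem_extChartAt_target _)
  · exact hbase ▸ (isContactPair_iff_formInChart η _).1 (hη.isContactPair _)

end ContactExtension

section Hamiltonian

variable {E : Type*} [NormedAddCommGroup E] [NormedSpace ℝ E]
  {H : Type*} [TopologicalSpace H] {I : ModelWithCorners ℝ E H}
  {M : Type*} [TopologicalSpace M] [ChartedSpace H M] [IsManifold I ∞ M]

theorem IsSmoothField.contMDiff_dirDeriv {X : VectorField I M} (hX : IsSmoothField I X)
    {f : M → ℝ} (hf : ContMDiff I 𝓘(ℝ, ℝ) ∞ f) : ContMDiff I 𝓘(ℝ, ℝ) ∞ (dirDeriv I X f) :=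
  contMDiff_snd_tangentBundle_modelSpace ℝ 𝓘(ℝ, ℝ) |>.comp
    ((hf.contMDiff_tangentMap le_rfl).comp hX)

theorem IsSmoothForm.contMDiff_apply_field {η : OneForm I M} (hη : IsSmoothForm I η)
    {X : VectorField I M} (hX : IsSmoothField I X) :
    ContMDiff I 𝓘(ℝ, ℝ) ∞ fun x ↦ η x (X x) :=
  fun x ↦ hη.contMDiffAt_apply (hX x)

variable [I.Boundaryless] {η : OneForm I M}

theorem IsContactForm.reeb_spec (hη : IsContactForm I η) (x : M) :
    η x (reeb I η x) = 1 ∧ ∀ w, extDerivForm I η x (reeb I η x) w = 0 :=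
  Classical.epsilon_spec (hη.isContactPair x).exists_reeb

theorem IsContactForm.flat_formInChart_reeb (hη : IsContactForm I η) {x₀ x : M}
    (hx : x ∈ (extChartAt I x₀).source) :
    (bilinExtDeriv (formInChart I η x₀) (extChartAt I x₀ x) +
      (formInChart I η x₀ (extChartAt I x₀ x)).smulRight
        (formInChart I η x₀ (extChartAt I x₀ x)))
      (mfderiv I 𝓘(ℝ, E) (extChartAt I x₀) x (reeb I η x)) =
        formInChart I η x₀ (extChartAt I x₀ x) := by
  refine ContinuousLinearMap.ext fun w ↦ ?_
  obtain ⟨w, rfl⟩ := (isInvertible_mfderiv_extChartAt (I := I) hx).surjective w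
  have ha := (formInChart_extChartAt_mfderiv η hx _).trans (hη.reeb_spec x).1
  have hb := (hη.1.extDerivForm_eq_bilinExtDeriv_formInChart hx (reeb I η x) w).symm.trans
    ((hη.reeb_spec x).2 w)
  exact (congrArg₂ (fun s t ↦ s + t * _) hb ha).trans ((zero_add _).trans (one_mul _))

theorem IsContactForm.isSmoothField_reeb (hη : IsContactForm I η) :
    IsSmoothField I (reeb I η) := by
  obtain ⟨n, hn, -⟩ := hη.2
  have : FiniteDimensional ℝ E := Module.finite_of_finrank_pos (by omega)
  have : CompleteSpace E := FiniteDimensional.complete ℝ E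
  intro x₀
  let α := formInChart I η x₀
  let B : E → E →L[ℝ] E →L[ℝ] ℝ := fun y ↦ bilinExtDeriv α y + (α y).smulRight (α y)
  have hα := hη.1.contDiffAt_formInChart (mem_extChartAt_target (I := I) x₀)
  have hB : ContDiffAt ℝ ∞ B (extChartAt I x₀ x₀) :=
    (contDiffAt_bilinExtDeriv hα).add (hα.smulRight hα)
  have hinv : (B (extChartAt I x₀ x₀)).IsInvertible :=
    ((isContactPair_iff_formInChart η x₀).1 (hη.isContactPair x₀)).isInvertible_flat
  have hR : ContDiffAt ℝ ∞ (fun y ↦ (B y).inverse (α y)) (extChartAt I x₀ x₀) :=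
    (ContDiffAt.comp (g := ContinuousLinearMap.inverse) _ hinv.contDiffAt_map_inverse hB).clm_apply
      hα
  have hev : ∀ᶠ x in 𝓝 x₀, (B (extChartAt I x₀ x)).IsInvertible := by
    obtain ⟨e, he⟩ := hinv
    have h := (hB.continuousAt.comp (continuousAt_extChartAt (I := I) x₀)).tendsto
    refine h.eventually ?_
    rw [Function.comp_apply, ← he]
    exact e.nhds
  refine ((trivializationAt E (TangentSpace I : M → Type _) x₀).contMDiffAt_section_iff
    (by simp)).2 ?_
  refine (hR.contMDiffAt.comp x₀ contMDiffAt_extChartAt).congr_of_eventuallyEq ?_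
  filter_upwards [hev, extChartAt_source_mem_nhds (I := I) x₀] with x hBx hx
  exact (trivializationAt_tangent_snd hx _).trans
    (hBx.inverse_apply_eq.2 (hη.flat_formInChart_reeb hx).symm).symm

theorem IsContactForm.eq_hamiltonianField_iff (hη : IsContactForm I η) (X : VectorField I M)
    (F : M → ℝ) (x : M) :
    X x = hamiltonianField I η F x ↔ η x (X x) = -F x ∧
      ∀ w, extDerivForm I η x (X x) w =
        mvfderiv I F x w - dirDeriv I (reeb I η) F x * η x w := by
  obtain ⟨n, hn, -⟩ := hη.2
  have : FiniteDimensional ℝ E := Module.finite_of_finrank_pos (by omega)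
  have hR := hη.reeb_spec x
  have h := (hη.isContactPair x).eq_sharpLambda_iff hR.1 hR.2 (mvfderiv I F x)
    (X x + F x • reeb I η x)
  refine eq_sub_iff_add_eq.trans (h.trans ?_)
  simp only [map_add, map_smul, hR.1, hR.2, add_apply, smul_apply, smul_eq_mul, mul_one, mul_zero,
    add_zero, eq_neg_iff_add_eq_zero]
  rfl

/-- The right-hand side says `L_X η = R(η(X)) η`, by Cartan's formula. -/
theorem IsContactForm.isHamiltonianField_iff (hη : IsContactForm I η) {X : VectorField I M}
    (hX : IsSmoothField I X) :
    IsHamiltonianField I η X ↔ ∀ x w, mvfderiv I (fun y ↦ η y (X y)) x w +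
      extDerivForm I η x (X x) w = dirDeriv I (reeb I η) (fun y ↦ η y (X y)) x * η x w := by
  have hneg : ∀ x w, mvfderiv I (fun y ↦ -η y (X y)) x w = -mvfderiv I (fun y ↦ η y (X y)) x w :=
    fun _ ↦ DFunLike.congr_fun mvfderiv_fun_neg
  have hRneg : ∀ x, dirDeriv I (reeb I η) (fun y ↦ -η y (X y)) x =
      -dirDeriv I (reeb I η) (fun y ↦ η y (X y)) x :=
    fun x ↦ hneg x (reeb I η x)
  constructor
  · rintro ⟨F, -, hXF⟩ x w
    have h := fun x ↦ (hη.eq_hamiltonianField_iff X F x).1 (congrFun hXF x)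
    obtain rfl : F = fun y ↦ -η y (X y) := funext fun y ↦ by rw [(h y).1, neg_neg]
    rw [(h x).2 w, hneg, hRneg]
    ring
  · intro h
    refine ⟨fun y ↦ -η y (X y), (hη.1.contMDiff_apply_field hX).neg, funext fun x ↦ ?_⟩
    refine (hη.eq_hamiltonianField_iff X _ x).2 ⟨(neg_neg _).symm, fun w ↦ ?_⟩
    rw [hneg, hRneg]
    linarith [h x w]

theorem IsContactForm.contMDiff_extendedField (hη : IsContactForm I η) {X : VectorField I M}
    (hX : IsSmoothField I X) :
    ContMDiff I (I.tangent.prod 𝓘(ℝ, ℝ)) ∞ (extendedField I η X) :=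
  hX.prodMk
    (hη.isSmoothField_reeb.contMDiff_dirDeriv (hη.1.contMDiff_apply_field hX)).neg

theorem IsContactForm.isHamiltonianField_iff_extendedForm_mfderiv_eq_zero
    (hη : IsContactForm I η) {X : VectorField I M} (hX : IsSmoothField I X) :
    IsHamiltonianField I η X ↔ ∀ x (w : TangentSpace I x),
      extendedForm I η (extendedField I η X x)
        (mfderiv I (I.tangent.prod 𝓘(ℝ, ℝ)) (extendedField I η X) x w) = 0 := by
  refine (hη.isHamiltonianField_iff hX).trans (forall₂_congr fun x w ↦ ?_)
  have h := hη.1.extendedForm_mfderiv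
    ((hη.contMDiff_extendedField hX).mdifferentiableAt (x := x) (by simp)) w
  have hproj : mfderiv I I (fun z ↦ (extendedField I η X z).1.proj) x w = w :=
    DFunLike.congr_fun mfderiv_id w
  rw [hproj] at h
  rw [h, ← sub_eq_zero, sub_eq_add_neg, ← neg_mul]
  rfl

end Hamiltonian

section InverseFunction

variable {E : Type*} [NormedAddCommGroup E] [NormedSpace ℝ E]

theorem fderiv_comp_fderiv_of_idempotent {g : E → E} {a : E} (hg : DifferentiableAt ℝ g a)
    (hgg : ∀ᶠ z in 𝓝 a, g (g z) = g z) (hga : g a = a) :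
    fderiv ℝ g a ∘L fderiv ℝ g a = fderiv ℝ g a := by
  have hcomp : HasFDerivAt (g ∘ g) (fderiv ℝ g a ∘L fderiv ℝ g a) a :=
    HasFDerivAt.comp a (by rw [hga]; exact hg.hasFDerivAt) hg.hasFDerivAt
  exact (hcomp.congr_of_eventuallyEq (hgg.mono fun z hz ↦ hz.symm)).unique hg.hasFDerivAt

variable [CompleteSpace E]

theorem exists_openPartialHomeomorph_of_isInvertible_fderiv {F : Type*} [NormedAddCommGroup F]
    [NormedSpace ℝ F] {f : E → F} {U : Set E} (hU : IsOpen U)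
    (hf : ContDiffOn ℝ ∞ f U) {a : E} (ha : a ∈ U) (hfa : (fderiv ℝ f a).IsInvertible) :
    ∃ e : OpenPartialHomeomorph E F, ⇑e = f ∧ a ∈ e.source ∧ e.source ⊆ U ∧
      ContDiffOn ℝ ∞ e.symm e.target := by
  have hfU : ∀ z ∈ U, ContDiffAt ℝ ∞ f z := fun z hz ↦ hf.contDiffAt (hU.mem_nhds hz)
  have hfd : ∀ z ∈ U, HasFDerivAt f (fderiv ℝ f z) z := fun z hz ↦
    ((hfU z hz).differentiableAt (by simp)).hasFDerivAt
  obtain ⟨A, hA⟩ := hfa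
  let e := (hfU a ha).toOpenPartialHomeomorph f (hA ▸ hfd a ha) (by simp)
  let V := U ∩ fderiv ℝ f ⁻¹' range ((↑) : (E ≃L[ℝ] F) → E →L[ℝ] F)
  have hV : IsOpen V :=
    (hf.continuousOn_fderiv_of_isOpen hU (by simp)).isOpen_inter_preimage hU
      ContinuousLinearEquiv.isOpen
  refine ⟨e.restrOpen V hV, rfl,
    ⟨(hfU a ha).mem_toOpenPartialHomeomorph_source (hA ▸ hfd a ha) (by simp), ha, A, hA⟩,
    fun z hz ↦ hz.2.1, fun y hy ↦ ?_⟩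
  obtain ⟨hyU, B, hB⟩ : (e.restrOpen V hV).symm y ∈ V :=
    ((e.restrOpen V hV).map_target hy).2
  exact ((e.restrOpen V hV).contDiffAt_symm hy (hB ▸ hfd _ hyU)
    (hfU _ hyU)).contDiffWithinAt

/-- The chart `(1 - P) ∘ (1 - g) + P ∘ g`, with `P` the derivative of `g` at the fixed point,
conjugates `g` to its linear part `P`. -/
theorem exists_openPartialHomeomorph_fixedPoints_iff_mem_submodule {g : E → E} {U : Set E}
    (hU : IsOpen U) (hg : ContDiffOn ℝ ∞ g U)
    (hgg : ∀ z ∈ U, g (g z) = g z) {a : E} (ha : a ∈ U) (hga : g a = a) :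
    ∃ e : OpenPartialHomeomorph E E, a ∈ e.source ∧ e.source ⊆ U ∧
      ContDiffOn ℝ ∞ e e.source ∧ ContDiffOn ℝ ∞ e.symm e.target ∧
      ∃ S : Submodule ℝ E, ∀ z ∈ e.source, g z = z ↔ e z ∈ S := by
  have hgd : DifferentiableAt ℝ g a := (hg.contDiffAt (hU.mem_nhds ha)).differentiableAt (by simp)
  let P := fderiv ℝ g a
  have hPP : ∀ v, P (P v) = P v := DFunLike.congr_fun
    (fderiv_comp_fderiv_of_idempotent hgd (Filter.eventually_of_mem (hU.mem_nhds ha) hgg) hga)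
  let ψ : E → E := fun z ↦ z - g z - P (z - g z) + P (g z)
  have hψ : ContDiffOn ℝ ∞ ψ U := by fun_prop
  have hψa : HasFDerivAt ψ (ContinuousLinearMap.id ℝ E) a := by
    have hid := (hasFDerivAt_id (𝕜 := ℝ) a).sub hgd.hasFDerivAt
    refine ((hid.sub (P.hasFDerivAt.comp a hid)).add
      (P.hasFDerivAt.comp a hgd.hasFDerivAt)).congr_fderiv (ContinuousLinearMap.ext fun v ↦ ?_)
    change v - P v - P (v - P v) + P (P v) = v
    rw [map_sub, hPP]
    abel
  have hPψ : ∀ z ∈ U, ψ (g z) = P (ψ z) := fun z hz ↦ by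
    simp only [ψ, hgg z hz, map_add, map_sub, hPP]
    abel
  obtain ⟨e, he, hae, -, hes⟩ := exists_openPartialHomeomorph_of_isInvertible_fderiv hU hψ ha
    (hψa.fderiv ▸ ⟨.refl ℝ E, rfl⟩)
  have hV : IsOpen (U ∩ g ⁻¹' e.source) :=
    hg.continuousOn.isOpen_inter_preimage hU e.open_source
  refine ⟨e.restrOpen _ hV, ⟨hae, ha, ?_⟩, fun z hz ↦ hz.2.1, ?_, hes.mono inter_subset_left,
    LinearMap.eqLocus P.toLinearMap LinearMap.id, fun z ⟨hze, hzU, hgz⟩ ↦ ?_⟩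
  · rwa [mem_preimage, hga]
  · exact he ▸ hψ.mono fun z hz ↦ hz.2.1
  · rw [← e.injOn.eq_iff hgz hze, he, hPψ z hzU, ← he]
    rfl

end InverseFunction

section Submanifold

variable {E : Type*} [NormedAddCommGroup E] [NormedSpace ℝ E]
  {H : Type*} [TopologicalSpace H] {I : ModelWithCorners ℝ E H} [I.Boundaryless]
  {M : Type*} [TopologicalSpace M] [ChartedSpace H M] [IsManifold I ∞ M]

theorem exists_mem_maximalAtlas_extend_eq_comp_extChartAt (p : M)
    {e : OpenPartialHomeomorph E E} (he : ContDiffOn ℝ ∞ e e.source)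
    (hes : ContDiffOn ℝ ∞ e.symm e.target) :
    ∃ φ ∈ IsManifold.maximalAtlas I ∞ M,
      φ.source = (extChartAt I p).source ∩ extChartAt I p ⁻¹' e.source ∧
        φ.extend I = e ∘ extChartAt I p := by
  let c : OpenPartialHomeomorph M E := (chartAt H p).transHomeomorph I.toHomeomorph
  have hc : ContMDiffOn I 𝓘(ℝ, E) ∞ c c.source := contMDiffOn_extChartAt
  have hcs : ContMDiffOn 𝓘(ℝ, E) I ∞ c.symm c.target := by
    refine (contMDiffOn_extChartAt_symm p).mono fun y hy ↦ ?_
    rw [extChartAt_target, I.range_eq_univ, inter_univ]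
    exact hy
  have hI : ContMDiff 𝓘(ℝ, E) I ∞ I.symm :=
    contMDiffOn_univ.1 (I.range_eq_univ ▸ I.contMDiffOn_symm)
  refine ⟨(c ≫ₕ e).transHomeomorph I.toHomeomorph.symm,
    OpenPartialHomeomorph.mem_maximalAtlas_of_contMDiffOn _ ?_ ?_, ?_, ?_⟩
  · exact hI.comp_contMDiffOn (he.contMDiffOn.comp' hc)
  · exact (hcs.comp' hes.contMDiffOn).comp I.contMDiff.contMDiffOn fun y hy ↦ hy
  · rw [extChartAt_source]
    rfl
  · exact funext fun q ↦ I.right_inv (by simp [I.range_eq_univ])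

theorem isSubmanifold_range_of_idempotent [CompleteSpace E] {ρ : M → M} (hρ : ContMDiff I I ∞ ρ)
    (hρρ : ∀ q, ρ (ρ q) = ρ q) : IsSubmanifold I (range ρ) := by
  rintro _ ⟨p, rfl⟩
  let φ := extChartAt I (ρ p)
  let g : E → E := φ ∘ ρ ∘ φ.symm
  let U : Set E := φ.target ∩ φ.symm ⁻¹' (ρ ⁻¹' φ.source)
  have hU : IsOpen U := (continuousOn_extChartAt_symm (ρ p)).isOpen_inter_preimage
    (isOpen_extChartAt_target (ρ p))
    ((isOpen_extChartAt_source (ρ p)).preimage hρ.continuous)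
  have hg : ContDiffOn ℝ ∞ g U := by
    refine ContMDiffOn.contDiffOn (contMDiffOn_extChartAt.comp
      (hρ.comp_contMDiffOn ((contMDiffOn_extChartAt_symm (ρ p)).mono inter_subset_left))
      fun z hz ↦ ?_)
    rw [← extChartAt_source I]
    exact hz.2
  have hgφ : ∀ q ∈ φ.source, g (φ q) = φ (ρ q) := fun q hq ↦
    congrArg (fun z ↦ φ (ρ z)) (φ.left_inv hq)
  have hgg : ∀ z ∈ U, g (g z) = g z := fun z hz ↦
    (hgφ _ hz.2).trans (congrArg φ (hρρ _))
  have hp : ρ p ∈ φ.source := mem_extChartAt_source (ρ p)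
  have hρφ : ∀ q ∈ φ.source, φ q ∈ U ↔ ρ q ∈ φ.source := fun q hq ↦ by
    change φ q ∈ φ.target ∧ ρ (φ.symm (φ q)) ∈ φ.source ↔ _
    rw [φ.left_inv hq, and_iff_right (φ.map_source hq)]
  have hpU : φ (ρ p) ∈ U := (hρφ _ hp).2 (by rwa [hρρ])
  obtain ⟨e, hpe, heU, he, hes, S, hS⟩ :=
    exists_openPartialHomeomorph_fixedPoints_iff_mem_submodule hU hg hgg hpU
      ((hgφ _ hp).trans (congrArg φ (hρρ p)))
  obtain ⟨ψ, hψ, hψs, hψe⟩ :=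
    exists_mem_maximalAtlas_extend_eq_comp_extChartAt (I := I) (ρ p) he hes
  refine ⟨ψ, hψ, hψs ▸ ⟨hp, hpe⟩, S, fun q hq ↦ ?_⟩
  rw [hψs] at hq
  have hρq : ρ q ∈ φ.source := (hρφ q hq.1).1 (heU hq.2)
  calc q ∈ range ρ ↔ ρ q = q := ⟨fun ⟨z, hz⟩ ↦ hz ▸ hρρ z, fun h ↦ ⟨q, h⟩⟩
    _ ↔ g (φ q) = φ q := by rw [hgφ q hq.1, φ.injOn.eq_iff hρq hq.1]
    _ ↔ ψ.extend I q ∈ S := by rw [hψe]; exact hS _ hq.2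

end Submanifold

section TangentSpace

variable {E : Type*} [NormedAddCommGroup E] [NormedSpace ℝ E]
  {H : Type*} [TopologicalSpace H] {I : ModelWithCorners ℝ E H}
  {M : Type*} [TopologicalSpace M] [ChartedSpace H M]
  {E' : Type*} [NormedAddCommGroup E'] [NormedSpace ℝ E']
  {H' : Type*} [TopologicalSpace H'] {I' : ModelWithCorners ℝ E' H'}
  {M' : Type*} [TopologicalSpace M'] [ChartedSpace H' M']

theorem mfderiv_injective_of_leftInverse {f : M → M'} {r : M' → M} {x : M}
    (hr : MDifferentiableAt I' I r (f x)) (hf : MDifferentiableAt I I' f x)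
    (hrf : Function.LeftInverse r f) : Function.Injective (mfderiv I I' f x) := by
  have hcomp : (mfderiv I' I r (f x)).comp (mfderiv I I' f x) = .id ℝ (TangentSpace I x) :=
    (mfderiv_comp x hr hf).symm.trans (by rw [hrf.comp_eq_id, mfderiv_id])
  exact Function.LeftInverse.injective fun v ↦ DFunLike.congr_fun hcomp v

variable [IsManifold I ∞ M] [I.Boundaryless]

theorem exists_curve_mfderiv_eq (x : M) (u : E) :
    ∃ γ : ℝ → M, γ 0 = x ∧ ContMDiffAt 𝓘(ℝ, ℝ) I ∞ γ 0 ∧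
      (mfderiv 𝓘(ℝ, ℝ) I γ 0 (1 : ℝ) : E) = u := by
  let φ := extChartAt I x
  let l : ℝ → E := fun t ↦ φ x + t • u
  have hl0 : l 0 = φ x := (congrArg _ (zero_smul ℝ u)).trans (add_zero _)
  have hl : ContDiff ℝ ∞ l := contDiff_const.add (contDiff_id.smul contDiff_const)
  have hlu : HasFDerivAt l ((ContinuousLinearMap.id ℝ ℝ).smulRight u) 0 :=
    ((hasFDerivAt_id (𝕜 := ℝ) (0 : ℝ)).smul_const u).const_add (φ x)
  have hφ : ContMDiffAt 𝓘(ℝ, E) I ∞ φ.symm (l 0) :=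
    hl0 ▸ contMDiffAt_extChartAt_symm (mem_extChartAt_target x)
  have hγ0 : φ.symm (l 0) = x := (congrArg φ.symm hl0).trans (extChartAt_to_inv x)
  have hγ : ContMDiffAt 𝓘(ℝ, ℝ) I ∞ (φ.symm ∘ l) 0 := hφ.comp 0 hl.contMDiff.contMDiffAt
  have hφγ : φ ∘ φ.symm ∘ l =ᶠ[𝓝 0] l := by
    filter_upwards [hl.continuous.continuousAt.preimage_mem_nhds
      (hl0 ▸ extChartAt_target_mem_nhds x)] with t ht
    exact φ.right_inv ht
  have hid : (mfderiv I 𝓘(ℝ, E) φ (φ.symm (l 0)) : E →L[ℝ] E) = .id ℝ E := by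
    rw [hγ0]
    exact mfderiv_extChartAt_self
  refine ⟨φ.symm ∘ l, hγ0, hγ, ?_⟩
  have hchain : mfderiv 𝓘(ℝ, ℝ) 𝓘(ℝ, E) (φ ∘ φ.symm ∘ l) 0 (1 : ℝ) =
      mfderiv I 𝓘(ℝ, E) φ (φ.symm (l 0)) (mfderiv 𝓘(ℝ, ℝ) I (φ.symm ∘ l) 0 (1 : ℝ)) :=
    mfderiv_comp_apply 0 (mdifferentiableAt_extChartAt (hγ0 ▸ mem_chart_source H x))
      (hγ.mdifferentiableAt (by simp)) (1 : ℝ)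
  rw [hφγ.mfderiv_eq, mfderiv_eq_fderiv, hlu.fderiv] at hchain
  exact (DFunLike.congr_fun hid _).symm.trans (hchain.symm.trans (one_smul ℝ u))

theorem tangentSpaceOf_range {f : M → M'} (hf : ContMDiff I I' ∞ f) {r : M' → M}
    (hr : ContMDiff I' I ∞ r) (hrf : Function.LeftInverse r f) (x : M) :
    tangentSpaceOf I' (range f) (f x) = (mfderiv I I' f x).range := by
  refine Set.ext fun v ↦ ⟨?_, ?_⟩
  · rintro ⟨γ, h0, hγ, hγf, hv⟩
    have hfrγ : γ =ᶠ[𝓝 0] f ∘ r ∘ γ := by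
      filter_upwards [hγf] with t ⟨z, hz⟩
      rw [Function.comp_apply, Function.comp_apply, ← hz, hrf]
    have hrγ : MDifferentiableAt 𝓘(ℝ, ℝ) I (r ∘ γ) 0 :=
      (hr.contMDiffAt.comp 0 hγ).mdifferentiableAt (by simp)
    have hx : r (γ 0) = x := h0 ▸ hrf x
    have hchain : mfderiv 𝓘(ℝ, ℝ) I' (f ∘ r ∘ γ) 0 (1 : ℝ) =
        mfderiv I I' f (r (γ 0)) (mfderiv 𝓘(ℝ, ℝ) I (r ∘ γ) 0 (1 : ℝ)) :=
      mfderiv_comp_apply 0 (hf.mdifferentiableAt (by simp)) hrγ (1 : ℝ)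
    subst hx
    refine ⟨mfderiv 𝓘(ℝ, ℝ) I (r ∘ γ) 0 (1 : ℝ), ?_⟩
    refine hchain.symm.trans (Eq.trans ?_ hv)
    exact congrArg (fun g : ℝ →L[ℝ] E' ↦ g 1) hfrγ.mfderiv_eq.symm
  · rintro ⟨u, rfl⟩
    obtain ⟨γ, rfl, hγ, hγu⟩ := exists_curve_mfderiv_eq (E := E) (I := I) x u
    refine ⟨f ∘ γ, rfl, hf.contMDiffAt.comp 0 hγ, .of_forall fun t ↦ ⟨γ t, rfl⟩, ?_⟩
    refine (mfderiv_comp_apply 0 (hf.mdifferentiableAt (by simp))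
      (hγ.mdifferentiableAt (by simp)) (1 : ℝ)).trans ?_
    exact congrArg (mfderiv I I' f (γ 0)) hγu

end TangentSpace

section Legendrian

variable {E : Type*} [NormedAddCommGroup E] [NormedSpace ℝ E]
  {H : Type*} [TopologicalSpace H] {I : ModelWithCorners ℝ E H}
  {M : Type*} [TopologicalSpace M] [ChartedSpace H M] [IsManifold I ∞ M] [I.Boundaryless]
  {η : OneForm I M}

theorem IsContactForm.mem_contactComplement_iff (hη : IsContactForm I η) {x : M}
    {Δ : Set (TangentSpace I x)} {u : TangentSpace I x} :
    u ∈ contactComplement I η x Δ ↔ ∃ α : TangentSpace I x →L[ℝ] ℝ, (∀ v ∈ Δ, α v = 0) ∧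
      η x u = 0 ∧ ∀ w, extDerivForm I η x u w = α w - α (reeb I η x) * η x w := by
  obtain ⟨n, hn, -⟩ := hη.2
  have : FiniteDimensional ℝ E := Module.finite_of_finrank_pos (by omega)
  have hR := hη.reeb_spec x
  refine exists_congr fun α ↦ and_congr_right fun _ ↦ ?_
  exact eq_comm.trans ((hη.isContactPair x).eq_sharpLambda_iff hR.1 hR.2 α u)

theorem IsContactForm.contactComplement_eq_of_isotropic (hη : IsContactForm I η) {x : M}
    {Δ : Submodule ℝ (TangentSpace I x)}
    (hΔ : Module.finrank ℝ E = 2 * Module.finrank ℝ Δ + 1) (ha : ∀ v ∈ Δ, η x v = 0)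
    (hb : ∀ v ∈ Δ, ∀ w ∈ Δ, extDerivForm I η x v w = 0) :
    contactComplement I η x Δ = Δ := by
  have : FiniteDimensional ℝ E := Module.finite_of_finrank_pos (by omega)
  have hx := hη.isContactPair x
  ext u
  rw [hη.mem_contactComplement_iff]
  constructor
  · rintro ⟨α, hα, hu, hαu⟩
    refine hx.mem_of_isotropic hΔ ha hb hu fun w hw ↦ (hαu w).trans ?_
    rw [hα w hw, ha w hw, mul_zero, sub_zero]
  · intro hu
    have huR : extDerivForm I η x u (reeb I η x) = 0 := hx.apply_reeb (hη.reeb_spec x).2 u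
    exact ⟨extDerivForm I η x u, hb u hu, ha u hu, fun w ↦ by rw [huR, zero_mul, sub_zero]⟩

theorem extDerivForm_zero (x : M) (u v : TangentSpace I x) :
    extDerivForm I (fun y ↦ (0 : TangentSpace I y →L[ℝ] ℝ)) x u v = 0 := by
  have hzero : formInChart I (fun y ↦ (0 : TangentSpace I y →L[ℝ] ℝ)) x = fun _ ↦ 0 :=
    funext fun y ↦ ContinuousLinearMap.zero_comp _
  have hbilin : bilinExtDeriv (fun _ : E ↦ (0 : E →L[ℝ] ℝ)) (extChartAt I x x) = 0 := by
    simp [bilinExtDeriv]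
  refine (extDerivForm_eq_bilinExtDeriv _ x u v).trans ?_
  rw [hzero, hbilin]
  rfl

variable {E' : Type*} [NormedAddCommGroup E'] [NormedSpace ℝ E']
  {H' : Type*} [TopologicalSpace H'] {I' : ModelWithCorners ℝ E' H'} [I'.Boundaryless]
  {M' : Type*} [TopologicalSpace M'] [ChartedSpace H' M'] [IsManifold I' ∞ M'] {θ : OneForm I' M'}

theorem IsContactForm.isLegendrian_range_iff (hθ : IsContactForm I' θ)
    (hdim : Module.finrank ℝ E' = 2 * Module.finrank ℝ E + 1) {f : M → M'}
    (hf : ContMDiff I I' ∞ f) {r : M' → M} (hr : ContMDiff I' I ∞ r)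
    (hrf : Function.LeftInverse r f) :
    IsLegendrian I' θ (range f) ↔
      ∀ x (w : TangentSpace I x), θ (f x) (mfderiv I I' f x w) = 0 := by
  have htan := tangentSpaceOf_range hf hr hrf
  constructor
  · rintro ⟨-, hL⟩ x w
    have hw : mfderiv I I' f x w ∈ tangentSpaceOf I' (range f) (f x) := by
      rw [htan]
      exact ⟨w, rfl⟩
    rw [hL _ ⟨x, rfl⟩] at hw
    obtain ⟨-, -, h, -⟩ := hθ.mem_contactComplement_iff.1 hw
    exact h
  · intro h
    have hrange : range f = range (f ∘ r) := by
      rw [range_comp, hrf.surjective.range_eq, image_univ]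
    have : FiniteDimensional ℝ E' := Module.finite_of_finrank_pos (by omega)
    have : CompleteSpace E' := FiniteDimensional.complete ℝ E'
    refine ⟨hrange ▸ isSubmanifold_range_of_idempotent (hf.comp hr)
      fun q ↦ congrArg f (hrf _), ?_⟩
    rintro _ ⟨x, rfl⟩
    rw [htan]
    refine (hθ.contactComplement_eq_of_isotropic ?_ ?_ ?_).symm
    · rw [hdim, LinearMap.finrank_range_of_inj (mfderiv_injective_of_leftInverse
        (hr.mdifferentiableAt (by simp)) (hf.mdifferentiableAt (by simp)) hrf)]
      rfl
    · rintro _ ⟨w, rfl⟩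
      exact h x w
    · rintro _ ⟨u, rfl⟩ _ ⟨v, rfl⟩
      exact (hθ.1.extDerivForm_pullback hf.contMDiffAt
        (.of_forall fun z v ↦ (h z v).symm) u v).symm.trans (extDerivForm_zero x u v)

end Legendrian

end Contact

end

theorem mainTheorem7_general
    {E : Type*} [NormedAddCommGroup E] [NormedSpace ℝ E]
    {H : Type*} [TopologicalSpace H] {I : ModelWithCorners ℝ E H} [I.Boundaryless]
    {M : Type*} [TopologicalSpace M] [ChartedSpace H M] [IsManifold I ∞ M]
    {η : Contact.OneForm I M} (hη : Contact.IsContactForm I η)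
    {X : Contact.VectorField I M} (hX : Contact.IsSmoothField I X) :
    Contact.IsContactForm (I.tangent.prod 𝓘(ℝ, ℝ)) (Contact.extendedForm I η) ∧
      (Contact.IsHamiltonianField I η X ↔
        Contact.IsLegendrian (I.tangent.prod 𝓘(ℝ, ℝ)) (Contact.extendedForm I η)
          (Set.range (Contact.extendedField I η X))) := by
  obtain ⟨n, hn, -⟩ := hη.2
  have : FiniteDimensional ℝ E := Module.finite_of_finrank_pos (by omega)
  have hdim : Module.finrank ℝ ((E × E) × ℝ) = 2 * Module.finrank ℝ E + 1 := by
    rw [Module.finrank_prod, Module.finrank_prod, Module.finrank_self, two_mul]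
  refine ⟨hη.extendedForm, (hη.isHamiltonianField_iff_extendedForm_mfderiv_eq_zero hX).trans ?_⟩
  exact (hη.extendedForm.isLegendrian_range_iff hdim (hη.contMDiff_extendedField hX)
    (r := fun q ↦ q.1.proj)
    ((Bundle.contMDiff_proj (TangentSpace I : M → Type _)).comp contMDiff_fst) fun _ ↦ rfl).symm

theorem mainTheorem7
    {E : Type*} [NormedAddCommGroup E] [NormedSpace ℝ E] [FiniteDimensional ℝ E]
    {M : Type*} [TopologicalSpace M] [ChartedSpace E M]
    [IsManifold 𝓘(ℝ, E) ∞ M]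
    (η : Contact.OneForm 𝓘(ℝ, E) M) (hη : Contact.IsContactForm 𝓘(ℝ, E) η)
    (X : Contact.VectorField 𝓘(ℝ, E) M) (hX : Contact.IsSmoothField 𝓘(ℝ, E) X) :
    Contact.IsContactForm (𝓘(ℝ, E).tangent.prod 𝓘(ℝ, ℝ)) (Contact.extendedForm 𝓘(ℝ, E) η) ∧
      (Contact.IsHamiltonianField 𝓘(ℝ, E) η X ↔
        Contact.IsLegendrian (𝓘(ℝ, E).tangent.prod 𝓘(ℝ, ℝ)) (Contact.extendedForm 𝓘(ℝ, E) η)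
          (Set.range (Contact.extendedField 𝓘(ℝ, E) η X))) :=
  mainTheorem7_general hη hX
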